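/- **Model.** A network has layers $\mathcal K=\{0,\dots,K\}$. Layer $i$ has altitude $h_i\ge 0$, transmission power $P_i>0$ and association bias $B_i>0$; its receivers and its transmitters form independent homogeneous Poisson point processes in the plane, with densities $\lambda_{i,\mathrm{Rx}}\ge 0$ and $\lambda_{i,\mathrm{Tx}}\ge 0$. Put $h_{ij}=|h_i-h_j|$. A link of length $x$ between an $i$-layer receiver and a $j$-layer transmitter is LoS (L) with probability $\rho^{(\mathrm L)}_{ij}(x)\in[0,1]$ and NLoS (N) with probability $\rho^{(\mathrm N)}_{ij}(x)=1-\rho^{(\mathrm L)}_{ij}(x)$, independently of all else. The path loss exponents satisfy $2\le\alpha^{(\mathrm L)}\le\alpha^{(\mathrm N)}$. The channel gains are independent, $\Gamma(m^{(c)},1/m^{(c)})$-distributed for environment $c$; assume Rayleigh fading, $m^{(\mathrm L)}=m^{(\mathrm N)}=1$. The noise power is $\sigma^2\ge 0$ and the target SINR of a link from layer $j$ to layer $i$ is $\beta_{ij}>0$. In receiver-oriented association ($o=\mathrm r$) a typical $k$-layer receiver selects a transmitter; in transmitter-oriented association ($o=\mathrm t$) a typical $k$-layer transmitter selects a receiver.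 The selected node, among all layers $i$, maximizes $B_i x^{-1}$ (nearest criterion) or $B_i x^{-\alpha^{(c)}}$ (strongest criterion), where $x$ is the link length and $c$ its environment. All transmitters other than the one of the main link interfere. A transmission succeeds if a node is selected and the SINR at the receiver exceeds the target. The STP of layer $k$ is the probability of success. The ASE of layer $k$ is the link density ($\lambda_{k,\mathrm{Rx}}$ if $o=\mathrm r$, $\lambda_{k,\mathrm{Tx}}$ if $o=\mathrm t$) times the mean rate, the rate being $\log_2(1+\text{target SINR})$ upon success and $0$ otherwise. Fix layers $k,j$, and regard the STP and the ASE of layer $k$ as functions of the $j$-layer transmitter density $\lambda_{j,\mathrm{Tx}}\in[0,\infty)$, all other parameters being fixed. A density is called optimal if it maximizes the function in question, the maximum being nonzero. Let $$\epsilon_{ij}=\int_{h_{ij}}^\infty x\left(1-\frac{\rho_{ij}^{(\mathrm L)}(x)}{1+\beta_{ij}h_{ij}^{\alpha^{(\mathrm L)}}x^{-\alpha^{(\mathrm L)}}}-\frac{\rho_{ij}^{(\mathrm N)}(x)}{1+\beta_{ij}h_{ij}^{\alpha^{(\mathrm L)}}x^{-\alpha^{(\mathrm N)}}}\right)dx\in[0,\infty],$$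 with $1/0=\infty$ and $1/\infty=0$. We say that a pair $(i,l)$ is admissible if $h_{il}\notin(0,1)$ or $\alpha^{(\mathrm L)}=\alpha^{(\mathrm N)}$. **Statement.** For either criterion: 1. If $o=\mathrm r$ and $(k,j)$ is admissible, every $j$-layer transmitter density that is optimal for the STP of layer $k$, and every one that is optimal for its ASE, is at most $\frac{1}{2\pi\epsilon_{kj}}$. 2. If $o=\mathrm t$, every $j$-layer transmitter density that is optimal for the STP of layer $k$ is $0$. 3. If $o=\mathrm t$ and $k\ne j$, every $j$-layer transmitter density that is optimal for the ASE of layer $k$ is $0$. 4. If $o=\mathrm t$, $k=j$, and $(i,k)$ is admissible for every layer $i$ with $\lambda_{i,\mathrm{Rx}}>0$, every $j$-layer transmitter density that is optimal for the ASE of layer $k$ is at most $\max_i\frac{1}{2\pi\epsilon_{ik}}$, the maximum (equal to $0$ if there is no such $i$) being over the layers $i$ with $\lambda_{i,\mathrm{Rx}}>0$. Moreover, in each case the function in question is strictly decreasing on the densities that are at least the stated bound, as long as it is nonzero. -/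

import Mathlib

open MeasureTheory ProbabilityTheory
open scoped ENNReal NNReal

namespace MAN

/-! ## Poisson point processes -/

/-- `Φ` is a (simple) Poisson point process on `E` with intensity measure `μ`: the number of points
in a measurable set is a random variable, Poisson distributed with mean `μ B` when this is finite,
and the numbers of points in pairwise disjoint measurable sets are independent. -/
structure IsPoissonProcess {Ω E : Type*} [MeasurableSpace Ω] [MeasurableSpace E]
    (P : Measure Ω) (μ : Measure E) (Φ : Ω → Set E) : Prop where
  measurable_count : ∀ B : Set E, MeasurableSet B → Measurable fun ω => (Φ ω ∩ B).encard
  law_count : ∀ B : Set E, MeasurableSet B → μ B ≠ ∞ →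
    P.map (fun ω => (Φ ω ∩ B).encard) =
      (poissonMeasure (μ B).toNNReal).map (fun n : ℕ => (n : ℕ∞))
  indep_count : ∀ B : ℕ → Set E, (∀ n, MeasurableSet (B n)) →
    Pairwise (fun m n => Disjoint (B m) (B n)) →
    iIndepFun (fun n ω => (Φ ω ∩ B n).encard) P

/-- The σ-algebra on `Ω` generated by a random set of points, through its counting variables. -/
@[reducible] noncomputable def countSigma {Ω E : Type*} [MeasurableSpace E] (Φ : Ω → Set E) : MeasurableSpace Ω :=
  ⨆ B : {B : Set E // MeasurableSet B},
    MeasurableSpace.comap (fun ω => (Φ ω ∩ B.1).encard) inferInstance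

/-! ## The network -/

/-- Channel environment of a link: line of sight or non line of sight. -/
inductive Channel
  | los
  | nlos
  deriving DecidableEq

instance : Fintype Channel where
  elems := {.los, .nlos}
  complete := by intro c; cases c <;> decide

instance : MeasurableSpace Channel := ⊤

/-- Association subject: does the receiver select the transmitter, or conversely? -/
inductive Subject
  | receiver
  | transmitter

/-- Association criterion: (biased) nearest distance or (biased) strongest power. -/
inductive Criterion
  | nearest
  | strongest

/-- Parameters of a network with layers `0, …, K`. In quantities with two layer indices, the first
one is the layer of the receiver and the second one that of the transmitter. -/
structure Network (K : ℕ) where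
  /-- altitude -/
  h : Fin (K + 1) → ℝ
  h_nonneg : ∀ i, 0 ≤ h i
  /-- transmission power -/
  power : Fin (K + 1) → ℝ
  power_pos : ∀ i, 0 < power i
  /-- association bias -/
  bias : Fin (K + 1) → ℝ
  bias_pos : ∀ i, 0 < bias i
  /-- density of the receivers -/
  lamRx : Fin (K + 1) → ℝ≥0
  /-- density of the transmitters -/
  lamTx : Fin (K + 1) → ℝ≥0
  /-- path loss exponents -/
  α : Channel → ℝ
  two_le_α : 2 ≤ α .los
  α_le : α .los ≤ α .nlos
  /-- Nakagami fading parameters -/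
  m : Channel → ℕ
  one_le_m : ∀ c, 1 ≤ m c
  /-- target SINR -/
  β : Fin (K + 1) → Fin (K + 1) → ℝ
  β_pos : ∀ i j, 0 < β i j
  /-- noise power -/
  noise : ℝ≥0
  /-- probability of line of sight at a given link distance -/
  ρL : Fin (K + 1) → Fin (K + 1) → ℝ → ℝ
  ρL_measurable : ∀ i j, Measurable (ρL i j)
  ρL_mem : ∀ i j x, ρL i j x ∈ Set.Icc (0 : ℝ) 1

/-- A node as seen from a typical node placed above the origin: its layer, the channel environment
of the link, its horizontal position, and the fading gain of the link. -/
abbrev Node (K : ℕ) : Type :=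
  Fin (K + 1) × Channel × EuclideanSpace ℝ (Fin 2) × ℝ

namespace Network

variable {K : ℕ} (N : Network K)

/-- The same network with the transmitter density of layer `j` set to `t`. -/
def withTx (j : Fin (K + 1)) (t : ℝ≥0) : Network K :=
  { N with lamTx := Function.update N.lamTx j t }

/-- Altitude difference of two layers. -/
def altDiff (i j : Fin (K + 1)) : ℝ := |N.h i - N.h j|

/-- Probability of a channel environment at link distance `x`. -/
def ρ (i j : Fin (K + 1)) : Channel → ℝ → ℝ
  | .los, x => N.ρL i j x
  | .nlos, x => 1 - N.ρL i j x

/-- Link distance between nodes of layers `i` and `j` with horizontal displacement `z`. -/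
noncomputable def dist (i j : Fin (K + 1)) (z : EuclideanSpace ℝ (Fin 2)) : ℝ :=
  √(‖z‖ ^ 2 + N.altDiff i j ^ 2)

/-- Law of the fading gain: Gamma with shape `m` and scale `1 / m` (that is, rate `m`). -/
noncomputable def gainLaw (c : Channel) : Measure ℝ := gammaMeasure (N.m c) (N.m c)

/-- Intensity of the marked transmitters seen from a typical receiver of layer `i`: independent
homogeneous processes of density `lamTx l` in the layers, each link having environment `c` with
probability `ρ i l c` of its length, and an independent fading gain. -/
noncomputable def txIntensity (i : Fin (K + 1)) : Measure (Node K) :=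
  ∑ l : Fin (K + 1), ∑ c : Channel, (N.lamTx l) •
    (Measure.dirac l).prod ((Measure.dirac c).prod
      ((volume.withDensity fun z => ENNReal.ofReal (N.ρ i l c (N.dist i l z))).prod (N.gainLaw c)))

/-- Intensity of the marked receivers seen from a typical transmitter of layer `k`. -/
noncomputable def rxIntensity (k : Fin (K + 1)) : Measure (Node K) :=
  ∑ l : Fin (K + 1), ∑ c : Channel, (N.lamRx l) •
    (Measure.dirac l).prod ((Measure.dirac c).prod
      ((volume.withDensity fun z => ENNReal.ofReal (N.ρ l k c (N.dist l k z))).prod (N.gainLaw c)))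

/-- A random realization of the network. `Tx i` are the transmitters (for the transmitter-oriented
association: other than the one under consideration) seen from a receiver of layer `i`, and
`Rx k` are the receivers seen from a transmitter of layer `k`. -/
structure IsRealization {Ω : Type*} [MeasurableSpace Ω] (P : Measure Ω)
    (Tx Rx : Fin (K + 1) → Ω → Set (Node K)) : Prop where
  tx_poisson : ∀ i, IsPoissonProcess P (N.txIntensity i) (Tx i)
  rx_poisson : ∀ k, IsPoissonProcess P (N.rxIntensity k) (Rx k)
  indep : ∀ k i, Indep (countSigma (Rx k)) (countSigma (Tx i)) P

/-! ## Association -/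

/-- The quantity that the associated node of a typical node of layer `k` maximizes. -/
noncomputable def assocValue (k : Fin (K + 1)) : Criterion → Node K → ℝ
  | .nearest, (l, _, z, _) => N.bias l * (N.dist k l z)⁻¹
  | .strongest, (l, c, z, _) => N.bias l * N.dist k l z ^ (-N.α c)

/-- Among the candidates `S`, the typical node of layer `k` is associated with `x`. -/
def IsAssociated (k : Fin (K + 1)) (a : Criterion) (S : Set (Node K)) (x : Node K) : Prop :=
  x ∈ S ∧ ∀ y ∈ S, y ≠ x → N.assocValue k a y < N.assocValue k a x

/-! ## SINR, STP and ASE -/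

/-- Power received over a link with environment `c`, length `d` and gain `g` from a transmitter of
layer `l`. -/
noncomputable def rxPower (l : Fin (K + 1)) (c : Channel) (d g : ℝ) : ℝ≥0∞ :=
  ENNReal.ofReal (N.power l * g * d ^ (-N.α c))

/-- Interference at a receiver of layer `i` from the set `S` of transmitters. -/
noncomputable def interference (i : Fin (K + 1)) (S : Set (Node K)) : ℝ≥0∞ :=
  ∑' x : S, N.rxPower x.1.1 x.1.2.1 (N.dist i x.1.1 x.1.2.2.1) x.1.2.2.2

/-- The typical receiver of layer `k` associates with a transmitter of layer `i` among the
transmitters `S`, and the SINR exceeds its target. -/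
def RxSuccess (k : Fin (K + 1)) (a : Criterion) (i : Fin (K + 1)) (S : Set (Node K)) : Prop :=
  ∃ (c : Channel) (z : EuclideanSpace ℝ (Fin 2)) (g : ℝ), N.IsAssociated k a S (i, c, z, g) ∧
    ENNReal.ofReal (N.β k i) <
      N.rxPower i c (N.dist k i z) g / (N.interference k (S \ {(i, c, z, g)}) + N.noise)

/-- The typical transmitter of layer `k` associates with a receiver of layer `i` among the
receivers `R`, and the SINR exceeds its target; `S i` are the interferers seen from a receiver of
layer `i`. -/
def TxSuccess (k : Fin (K + 1)) (a : Criterion) (i : Fin (K + 1)) (R : Set (Node K))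
    (S : Fin (K + 1) → Set (Node K)) : Prop :=
  ∃ (c : Channel) (z : EuclideanSpace ℝ (Fin 2)) (g : ℝ), N.IsAssociated k a R (i, c, z, g) ∧
    ENNReal.ofReal (N.β i k) <
      N.rxPower k c (N.dist i k z) g / (N.interference i (S i) + N.noise)

/-- Successful transmission to (`o = receiver`) or from (`o = transmitter`) the typical node of
layer `k`, its partner being in layer `i`. -/
def Success (o : Subject) (a : Criterion) (k i : Fin (K + 1)) {Ω : Type*}
    (Tx Rx : Fin (K + 1) → Ω → Set (Node K)) (ω : Ω) : Prop :=
  match o with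
  | .receiver => N.RxSuccess k a i (Tx k ω)
  | .transmitter => N.TxSuccess k a i (Rx k ω) (fun l => Tx l ω)

/-- Successful transmission probability of layer `k`. -/
noncomputable def STP (o : Subject) (a : Criterion) (k : Fin (K + 1)) {Ω : Type*}
    [MeasurableSpace Ω] (P : Measure Ω) (Tx Rx : Fin (K + 1) → Ω → Set (Node K)) : ℝ≥0∞ :=
  P {ω | ∃ i, N.Success o a k i Tx Rx ω}

/-- Density of the communication links of layer `k`. -/
def linkDensity (o : Subject) (k : Fin (K + 1)) : ℝ≥0 :=
  match o with
  | .receiver => N.lamRx k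
  | .transmitter => N.lamTx k

/-- Target rate of the link between the typical node of layer `k` and a partner in layer `i`. -/
noncomputable def rate (o : Subject) (k i : Fin (K + 1)) : ℝ :=
  match o with
  | .receiver => Real.logb 2 (1 + N.β k i)
  | .transmitter => Real.logb 2 (1 + N.β i k)

/-- Area spectral efficiency of layer `k`: link density times mean data rate, the data rate being
the target rate upon success and zero otherwise. -/
noncomputable def ASE (o : Subject) (a : Criterion) (k : Fin (K + 1)) {Ω : Type*}
    [MeasurableSpace Ω] (P : Measure Ω) (Tx Rx : Fin (K + 1) → Ω → Set (Node K)) : ℝ≥0∞ :=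
  N.linkDensity o k *
    ∑ i, ENNReal.ofReal (N.rate o k i) * P {ω | N.Success o a k i Tx Rx ω}

/-! ## The bounds -/

/-- The integral `ε i j`, with values in `[0, ∞]` (the integrand is nonnegative). -/
noncomputable def ε (i j : Fin (K + 1)) : ℝ≥0∞ :=
  ∫⁻ x in Set.Ioi (N.altDiff i j), ENNReal.ofReal
    (x * (1 - N.ρ i j .los x / (1 + N.β i j * N.altDiff i j ^ N.α .los * x ^ (-N.α .los))
            - N.ρ i j .nlos x / (1 + N.β i j * N.altDiff i j ^ N.α .los * x ^ (-N.α .nlos))))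

/-- `1 / (2 π ε i j)`, with the conventions `1 / 0 = ∞` and `1 / ∞ = 0`. -/
noncomputable def bound (i j : Fin (K + 1)) : ℝ≥0∞ :=
  (ENNReal.ofReal (2 * Real.pi) * N.ε i j)⁻¹

/-- The altitude difference is not strictly between `0` and `1`, unless the two path loss exponents
agree. -/
def Admissible (i j : Fin (K + 1)) : Prop :=
  N.altDiff i j ∈ Set.Ioo (0 : ℝ) 1 → N.α .los = N.α .nlos

end Network

/-- `t` is an optimal density for the performance `f`: it maximizes `f`, with a nonzero value. -/
def IsOptimalDensity (f : ℝ≥0 → ℝ≥0∞) (t : ℝ≥0) : Prop :=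
  0 < f t ∧ ∀ s, f s ≤ f t

/-- `b` bounds the optimal densities for `f` from above. The second part says that beyond `b` the
performance decreases strictly as long as it is nonzero, so that the bound is also meaningful when
the supremum of `f` is not attained. -/
def IsOptimalDensityBound (f : ℝ≥0 → ℝ≥0∞) (b : ℝ≥0∞) : Prop :=
  (∀ t, IsOptimalDensity f t → (t : ℝ≥0∞) ≤ b) ∧
    ∀ s t : ℝ≥0, b ≤ s → s < t → 0 < f t → f t < f s

end MAN

open MAN

namespace MAN

open Filter Topology Set

/-! ## The decreasing exponential on `[0, ∞]` -/

/-- The function `r ↦ e ^ (-r)` on `[0, ∞]`. -/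
noncomputable def expNeg (r : ℝ≥0∞) : ℝ≥0∞ := EReal.exp (-(r : EReal))

lemma expNeg_zero : expNeg 0 = 1 := by simp [expNeg]

lemma expNeg_top : expNeg ∞ = 0 := by simp [expNeg]

lemma expNeg_eq_inv (r : ℝ≥0∞) : expNeg r = (EReal.exp r)⁻¹ := EReal.exp_neg _

lemma expNeg_add (r s : ℝ≥0∞) : expNeg (r + s) = expNeg r * expNeg s := by
  have h (t : ℝ≥0∞) : EReal.exp t ≠ 0 := by simp [EReal.exp_eq_zero_iff]
  rw [expNeg_eq_inv, expNeg_eq_inv, expNeg_eq_inv, EReal.coe_ennreal_add, EReal.exp_add,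
    ENNReal.mul_inv (.inl (h r)) (.inr (h s))]

lemma expNeg_strictAnti : StrictAnti expNeg := fun r s h => by
  simpa [expNeg] using h

lemma expNeg_antitone : Antitone expNeg := expNeg_strictAnti.antitone

lemma expNeg_le_one (r : ℝ≥0∞) : expNeg r ≤ 1 := expNeg_zero ▸ expNeg_antitone (zero_le (a := r))

lemma expNeg_ne_top (r : ℝ≥0∞) : expNeg r ≠ ∞ := ne_top_of_le_ne_top ENNReal.one_ne_top (expNeg_le_one r)

lemma expNeg_ofReal {x : ℝ} (hx : 0 ≤ x) :
    expNeg (ENNReal.ofReal x) = ENNReal.ofReal (Real.exp (-x)) := by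
  rw [expNeg, EReal.coe_ennreal_ofReal, max_eq_left hx, ← EReal.coe_neg, EReal.exp_coe]

lemma expNeg_pos {r : ℝ≥0∞} (h : r ≠ ∞) : 0 < expNeg r :=
  expNeg_top ▸ expNeg_strictAnti h.lt_top

lemma continuous_expNeg : Continuous expNeg :=
  ENNReal.continuous_exp.comp (continuous_neg.comp continuous_coe_ennreal_ereal)

@[fun_prop]
lemma measurable_expNeg : Measurable expNeg := continuous_expNeg.measurable

lemma expNeg_natCast_mul (n : ℕ) (r : ℝ≥0∞) : expNeg (n * r) = expNeg r ^ n := by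
  induction n with
  | zero => simp [expNeg_zero]
  | succ n ih => rw [Nat.cast_succ, add_mul, one_mul, expNeg_add, ih, pow_succ]

lemma expNeg_sum {ι : Type*} (s : Finset ι) (f : ι → ℝ≥0∞) :
    expNeg (∑ i ∈ s, f i) = ∏ i ∈ s, expNeg (f i) := by
  classical
  induction s using Finset.induction_on with
  | empty => simp [expNeg_zero]
  | insert i s hi ih => rw [Finset.sum_insert hi, Finset.prod_insert hi, expNeg_add, ih]

/-- The bounded continuous function `r ↦ e ^ (-r)` on `[0, ∞]`. -/
noncomputable def expNegBCF : BoundedContinuousFunction ℝ≥0∞ ℝ :=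
  BoundedContinuousFunction.mkOfCompact
    ⟨fun r => (expNeg r).toReal, ENNReal.continuousOn_toReal.comp_continuous continuous_expNeg
      fun r => expNeg_ne_top r⟩

lemma expNegBCF_apply (r : ℝ≥0∞) : expNegBCF r = (expNeg r).toReal := rfl

/-- The polynomials in `e ^ (-r)`. -/
noncomputable def expNegAlgebra : StarSubalgebra ℝ (BoundedContinuousFunction ℝ≥0∞ ℝ) where
  toSubalgebra := (Polynomial.aeval (R := ℝ) expNegBCF).range
  star_mem' := by
    rintro _ h
    have h2 (f : BoundedContinuousFunction ℝ≥0∞ ℝ) : star f = f := by ext; simp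
    rw [h2]; exact h

/-- Finite measures on `[0, ∞]` are determined by their Laplace transform at the natural numbers. -/
theorem ext_of_forall_lintegral_expNeg {Q Q' : Measure ℝ≥0∞} [IsFiniteMeasure Q] [IsFiniteMeasure Q']
    (h : ∀ n : ℕ, ∫⁻ r, expNeg (n * r) ∂Q = ∫⁻ r, expNeg (n * r) ∂Q') : Q = Q' := by
  refine ext_of_forall_mem_subalgebra_integral_eq_of_polish (𝕜 := ℝ) (A := expNegAlgebra) ?_ ?_
  · intro r s hrs
    refine ⟨expNegBCF, ⟨expNegBCF.toContinuousMap, ⟨expNegBCF, ⟨Polynomial.X, by simp⟩, rfl⟩, rfl⟩, ?_⟩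
    change (expNeg r).toReal ≠ (expNeg s).toReal
    rw [Ne, ENNReal.toReal_eq_toReal_iff' (expNeg_ne_top _) (expNeg_ne_top _)]
    exact fun h => hrs (expNeg_strictAnti.injective h)
  · have key (n : ℕ) (S : Measure ℝ≥0∞) :
        ∫ x, (expNegBCF ^ n) x ∂S = (∫⁻ r, expNeg (n * r) ∂S).toReal := by
      rw [← integral_toReal (by fun_prop)
        (ae_of_all _ fun r => (expNeg_ne_top _).lt_top)]
      refine integral_congr_ae (ae_of_all _ fun r => ?_)
      simp [expNegBCF_apply, expNeg_natCast_mul]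
    rintro _ ⟨p, rfl⟩
    change ∫ x, (Polynomial.aeval expNegBCF p) x ∂Q = ∫ x, (Polynomial.aeval expNegBCF p) x ∂Q'
    induction p using Polynomial.induction_on' with
    | add p q hp hq =>
      simp only [map_add, BoundedContinuousFunction.coe_add, Pi.add_apply]
      rw [integral_add (BoundedContinuousFunction.integrable _ _)
        (BoundedContinuousFunction.integrable _ _), hp, hq,
        integral_add (BoundedContinuousFunction.integrable _ _)
        (BoundedContinuousFunction.integrable _ _)]
    | monomial n c =>
      simp only [Polynomial.aeval_monomial]
      simp only [Algebra.algebraMap_eq_smul_one, smul_mul_assoc, one_mul,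
        BoundedContinuousFunction.coe_smul]
      rw [integral_smul, integral_smul, key, key, h]

/-! ## Sums over a random set of points -/

section PointMeasure

variable {E : Type*} [MeasurableSpace E]

/-- The counting measure of a set of points. -/
noncomputable def pointMeasure (S : Set E) : Measure E := Measure.sum fun x : S => Measure.dirac x.1

lemma lintegral_pointMeasure (S : Set E) {f : E → ℝ≥0∞} (hf : Measurable f) :
    ∫⁻ x, f x ∂(pointMeasure S) = ∑' x : S, f x := by
  rw [pointMeasure, lintegral_sum_measure]
  exact tsum_congr fun x => lintegral_dirac' _ hf

lemma pointMeasure_apply (S : Set E) {B : Set E} (hB : MeasurableSet B) :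
    pointMeasure S B = ((S ∩ B).encard : ℝ≥0∞) := by
  rw [← lintegral_indicator_one hB, lintegral_pointMeasure _ (measurable_one.indicator hB),
    ← ENNReal.tsum_set_one, tsum_subtype S (B.indicator 1), tsum_subtype (S ∩ B) fun _ => (1 : ℝ≥0∞)]
  refine tsum_congr fun x => ?_
  rw [Set.indicator_indicator]
  rfl

variable {Ω : Type*}

lemma countSigma_le [MeasurableSpace Ω] {Φ : Ω → Set E}
    (h : ∀ B : Set E, MeasurableSet B → Measurable fun ω => (Φ ω ∩ B).encard) :
    countSigma Φ ≤ ‹MeasurableSpace Ω› :=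
  iSup_le fun B => (h B.1 B.2).comap_le

lemma measurable_encard_countSigma (Φ : Ω → Set E) {B : Set E} (hB : MeasurableSet B) :
    Measurable[countSigma Φ] fun ω => (Φ ω ∩ B).encard :=
  (comap_measurable _).mono
    (le_iSup (fun B : {B : Set E // MeasurableSet B} => MeasurableSpace.comap
      (fun ω => (Φ ω ∩ B.1).encard) inferInstance) ⟨B, hB⟩) le_rfl

lemma measurable_pointMeasure (Φ : Ω → Set E) :
    Measurable[countSigma Φ] fun ω => pointMeasure (Φ ω) := by
  refine Measure.measurable_of_measurable_coe _ fun B hB => ?_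
  simp_rw [pointMeasure_apply _ hB]
  exact (measurable_from_top (f := ENat.toENNReal)).comp (measurable_encard_countSigma Φ hB)

lemma measurable_tsum_points (Φ : Ω → Set E) {f : E → ℝ≥0∞} (hf : Measurable f) :
    Measurable[countSigma Φ] fun ω => ∑' x : Φ ω, f x := by
  simp_rw [← lintegral_pointMeasure _ hf]
  exact (Measure.measurable_lintegral hf).comp (measurable_pointMeasure Φ)

lemma lintegral_expNeg_poissonMeasure (r : ℝ≥0∞) (l : ℝ≥0) :
    ∫⁻ n : ℕ, expNeg (r * n) ∂(poissonMeasure l) = expNeg ((1 - expNeg r) * l) := by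
  set q : ℝ := (expNeg r).toReal with hq
  have hr : expNeg r = ENNReal.ofReal q := (ENNReal.ofReal_toReal (expNeg_ne_top r)).symm
  have hq0 : 0 ≤ q := ENNReal.toReal_nonneg
  have hq1 : q ≤ 1 := ENNReal.toReal_le_of_le_ofReal zero_le_one (by simpa using expNeg_le_one r)
  rw [lintegral_countable']
  have h (n : ℕ) : expNeg (r * n) * poissonMeasure l {n} =
      ENNReal.ofReal (Real.exp (-l) * ((l * q) ^ n / n.factorial)) := by
    rw [mul_comm r, expNeg_natCast_mul, hr, poissonMeasure_singleton, ← ENNReal.ofReal_pow hq0,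
      ← ENNReal.ofReal_mul (by positivity)]
    congr 1
    rw [mul_pow]
    ring
  have hs : HasSum (fun n : ℕ => Real.exp (-l) * ((l * q) ^ n / n.factorial))
      (Real.exp (-l) * Real.exp (l * q)) := by
    rw [Real.exp_eq_exp_ℝ]
    exact (NormedSpace.expSeries_div_hasSum_exp (𝔸 := ℝ) (l * q)).mul_left _
  simp_rw [h]
  rw [← ENNReal.ofReal_tsum_of_nonneg (fun n => by positivity) hs.summable, hs.tsum_eq, hr,
    ← ENNReal.ofReal_one, ← ENNReal.ofReal_sub _ hq0, ← ENNReal.ofReal_coe_nnreal,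
    ← ENNReal.ofReal_mul (by linarith), expNeg_ofReal (mul_nonneg (by linarith) l.coe_nonneg), ← Real.exp_add]
  congr 2
  ring

section Laplace

variable [mΩ : MeasurableSpace Ω] {P : Measure Ω} {μ : Measure E} {Φ : Ω → Set E}

lemma IsPoissonProcess.countSigma_le (h : IsPoissonProcess P μ Φ) : countSigma Φ ≤ mΩ :=
  MAN.countSigma_le h.measurable_count

lemma IsPoissonProcess.measurable_tsum (h : IsPoissonProcess P μ Φ) {f : E → ℝ≥0∞}
    (hf : Measurable f) : Measurable fun ω => ∑' x : Φ ω, f x :=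
  (measurable_tsum_points Φ hf).mono h.countSigma_le le_rfl

lemma IsPoissonProcess.lintegral_count (h : IsPoissonProcess P μ Φ) {B : Set E}
    (hB : MeasurableSet B) (hμ : μ B ≠ ∞) (f : ℕ∞ → ℝ≥0∞) :
    ∫⁻ ω, f (Φ ω ∩ B).encard ∂P = ∫⁻ n : ℕ, f n ∂(poissonMeasure (μ B).toNNReal) := by
  rw [← lintegral_map (f := f) measurable_from_top (h.measurable_count B hB), h.law_count B hB hμ,
    lintegral_map measurable_from_top measurable_from_top]

lemma IsPoissonProcess.lintegral_expNeg_count (h : IsPoissonProcess P μ Φ) [IsProbabilityMeasure P]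
    {B : Set E} (hB : MeasurableSet B) {r : ℝ≥0∞} (hμ : r ≠ 0 → μ B ≠ ∞) :
    ∫⁻ ω, expNeg (r * (Φ ω ∩ B).encard) ∂P = expNeg ((1 - expNeg r) * μ B) := by
  rcases eq_or_ne r 0 with rfl | hr
  · simp [expNeg_zero]
  · rw [h.lintegral_count hB (hμ hr) fun n => expNeg (r * n)]
    simp only [ENat.toENNReal_coe]
    rw [lintegral_expNeg_poissonMeasure, ENNReal.coe_toNNReal (hμ hr)]

lemma IsPoissonProcess.laplace_simpleFunc (h : IsPoissonProcess P μ Φ) [IsProbabilityMeasure P]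
    (g : SimpleFunc E ℝ≥0∞) (hμ : ∀ r, r ≠ 0 → μ (g ⁻¹' {r}) ≠ ∞) :
    ∫⁻ ω, expNeg (∑' x : Φ ω, g x) ∂P = expNeg (∫⁻ x, (1 - expNeg (g x)) ∂μ) := by
  have hB (r : ℝ≥0∞) : MeasurableSet (g ⁻¹' {r}) := g.measurableSet_fiber r
  have h1 (ω : Ω) : expNeg (∑' x : Φ ω, g x) =
      ∏ r : g.range, expNeg (r.1 * (Φ ω ∩ g ⁻¹' {r.1}).encard) := by
    rw [← lintegral_pointMeasure _ g.measurable, SimpleFunc.lintegral_eq_lintegral,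
      SimpleFunc.lintegral, expNeg_sum, ← Finset.prod_coe_sort]
    exact Finset.prod_congr rfl fun r _ => by rw [pointMeasure_apply _ (hB _)]
  have h2 : ∫⁻ x, (1 - expNeg (g x)) ∂μ = ∑ r : g.range, (1 - expNeg r) * μ (g ⁻¹' {r.1}) := by
    rw [Finset.sum_coe_sort g.range fun r => (1 - expNeg r) * μ (g ⁻¹' {r}),
      ← SimpleFunc.map_lintegral (fun r => 1 - expNeg r), ← SimpleFunc.lintegral_eq_lintegral]
    rfl
  simp_rw [h1, h2, expNeg_sum]
  have e := g.range.equivFin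
  have hind : iIndepFun (fun (r : g.range) ω => (Φ ω ∩ g ⁻¹' {r.1}).encard) P := by
    let B : ℕ → Set E := fun n =>
      if hn : n < g.range.card then g ⁻¹' {(e.symm ⟨n, hn⟩).1} else ∅
    have hBn : ∀ n, MeasurableSet (B n) := fun n => by
      by_cases hn : n < g.range.card
      · simp only [B, hn, dite_true]; exact hB _
      · simp [B, hn]
    have hdisj : Pairwise fun m n => Disjoint (B m) (B n) := by
      intro m n hmn
      by_cases hm : m < g.range.card <;> by_cases hn : n < g.range.card <;> simp only [B, hm, hn,
        dite_true, dite_false, Set.disjoint_empty, Set.empty_disjoint]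
      refine Disjoint.preimage _ (Set.disjoint_singleton.2 fun heq => hmn ?_)
      simpa using e.symm.injective (Subtype.ext heq)
    have := (h.indep_count B hBn hdisj).precomp (g := fun r : g.range => (e r : ℕ))
      (fun r s hrs => e.injective (Fin.ext hrs))
    convert this using 4 with r ω
    simp [B]
  refine (lintegral_prod_eq_prod_lintegral_of_indepFun Finset.univ
    (fun (r : g.range) ω => expNeg (r.1 * (Φ ω ∩ g ⁻¹' {r.1}).encard)) (hind.comp (fun r n => expNeg (r.1 * n)) fun _ => measurable_from_top)
    fun r => (measurable_from_top (f := fun n : ℕ∞ => expNeg (r.1 * n))).comp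
      (h.measurable_count _ (hB _))).trans ?_
  exact Finset.prod_congr rfl fun r _ => h.lintegral_expNeg_count (hB _) (hμ _)

/-- The Laplace functional of a Poisson process. -/
theorem IsPoissonProcess.laplace (h : IsPoissonProcess P μ Φ) [IsProbabilityMeasure P]
    [SigmaFinite μ] {g : E → ℝ≥0∞} (hg : Measurable g) :
    ∫⁻ ω, expNeg (∑' x : Φ ω, g x) ∂P = expNeg (∫⁻ x, (1 - expNeg (g x)) ∂μ) := by
  let G : ℕ → SimpleFunc E ℝ≥0∞ := fun n =>
    (SimpleFunc.eapprox g n).restrict (spanningSets μ n)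
  have hG (n : ℕ) (x : E) : G n x = (spanningSets μ n).indicator (SimpleFunc.eapprox g n) x :=
    SimpleFunc.restrict_apply _ (measurableSet_spanningSets μ n) x
  have hmono (x : E) : Monotone fun n => G n x := by
    intro m n hmn
    simp only [hG]
    refine (Set.indicator_le_indicator_of_subset (monotone_spanningSets μ hmn)
      (fun _ => zero_le) x).trans ?_
    exact Set.indicator_le_indicator (SimpleFunc.monotone_eapprox g hmn x)
  have hlim (x : E) : Tendsto (fun n => G n x) atTop (𝓝 (g x)) := by
    refine (SimpleFunc.tendsto_eapprox hg x).congr' ?_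
    filter_upwards [eventually_ge_atTop (spanningSetsIndex μ x)] with n hn
    rw [hG, Set.indicator_of_mem]
    exact monotone_spanningSets μ hn (mem_spanningSetsIndex μ x)
  have h1 (n : ℕ) : ∫⁻ ω, expNeg (∑' x : Φ ω, G n x) ∂P =
      expNeg (∫⁻ x, (1 - expNeg (G n x)) ∂μ) := by
    refine h.laplace_simpleFunc (G n) fun r hr => ne_top_of_le_ne_top
      (measure_spanningSets_lt_top μ n).ne (measure_mono fun x hx => ?_)
    by_contra hx'
    rw [mem_preimage, hG, Set.indicator_of_notMem hx'] at hx
    exact hr hx.symm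
  have h2 : Tendsto (fun n => ∫⁻ ω, expNeg (∑' x : Φ ω, G n x) ∂P) atTop
      (𝓝 (∫⁻ ω, expNeg (∑' x : Φ ω, g x) ∂P)) := by
    refine tendsto_lintegral_of_dominated_convergence (fun _ => 1)
      (fun n => measurable_expNeg.comp (h.measurable_tsum (G n).measurable))
      (fun n => ae_of_all _ fun ω => expNeg_le_one _) (by simp) (ae_of_all _ fun ω => ?_)
    refine (continuous_expNeg.tendsto _).comp ?_
    simp_rw [← lintegral_pointMeasure _ hg, ← lintegral_pointMeasure _ (G _).measurable]
    exact lintegral_tendsto_of_tendsto_of_monotone (fun n => (G n).measurable.aemeasurable)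
      (ae_of_all _ hmono) (ae_of_all _ hlim)
  have h3 : Tendsto (fun n => expNeg (∫⁻ x, (1 - expNeg (G n x)) ∂μ)) atTop
      (𝓝 (expNeg (∫⁻ x, (1 - expNeg (g x)) ∂μ))) := by
    refine (continuous_expNeg.tendsto _).comp ?_
    refine lintegral_tendsto_of_tendsto_of_monotone
      (fun n => (measurable_const.sub (measurable_expNeg.comp (G n).measurable)).aemeasurable)
      (ae_of_all _ fun x m n hmn => tsub_le_tsub_left (expNeg_antitone (hmono x hmn)) _)
      (ae_of_all _ fun x => ?_)
    exact ENNReal.Tendsto.sub tendsto_const_nhds ((continuous_expNeg.tendsto _).comp (hlim x))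
      (.inl ENNReal.one_ne_top)
  simp_rw [h1] at h2
  exact tendsto_nhds_unique h2 h3

end Laplace

end PointMeasure
/-! ## The Campbell–Mecke formula -/

lemma one_sub_expNeg_le (y : ℝ≥0∞) : 1 - expNeg y ≤ y := by
  rcases eq_or_ne y ∞ with rfl | hy
  · simp
  · lift y to ℝ≥0 using hy
    rw [← ENNReal.ofReal_coe_nnreal, expNeg_ofReal y.coe_nonneg, ← ENNReal.ofReal_one,
      ← ENNReal.ofReal_sub _ (Real.exp_nonneg _)]
    refine ENNReal.ofReal_le_ofReal ?_
    have := Real.add_one_le_exp (-(y : ℝ))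
    linarith

lemma div_le_one_sub_expNeg (y : ℝ≥0∞) : y / (1 + y) ≤ 1 - expNeg y := by
  rcases eq_or_ne y ∞ with rfl | hy
  · simp
  · lift y to ℝ≥0 using hy
    have h0 : (0 : ℝ) < 1 + y := by positivity
    rw [← ENNReal.ofReal_coe_nnreal, expNeg_ofReal y.coe_nonneg, ← ENNReal.ofReal_one,
      ← ENNReal.ofReal_sub _ (Real.exp_nonneg _), ← ENNReal.ofReal_add zero_le_one y.coe_nonneg,
      ← ENNReal.ofReal_div_of_pos h0]
    refine ENNReal.ofReal_le_ofReal ?_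
    have h1 := Real.add_one_le_exp (y : ℝ)
    have h2 : Real.exp (-(y : ℝ)) ≤ (1 + (y : ℝ))⁻¹ := by
      rw [Real.exp_neg]
      exact inv_anti₀ h0 (by linarith)
    have h3 : (y : ℝ) / (1 + y) = 1 - (1 + (y : ℝ))⁻¹ := by field_simp; ring
    linarith

lemma tendsto_natCast_mul_one_sub_expNeg {y : ℕ → ℝ≥0∞} {c : ℝ≥0∞} (hc : c ≠ ∞)
    (h : Tendsto (fun n => n * y n) atTop (𝓝 c)) :
    Tendsto (fun n => n * (1 - expNeg (y n))) atTop (𝓝 c) := by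
  have hy : Tendsto y atTop (𝓝 0) := by
    have h1 := ENNReal.Tendsto.mul ENNReal.tendsto_inv_nat_nhds_zero (.inr hc) h
      (.inr ENNReal.zero_ne_top)
    rw [zero_mul] at h1
    refine h1.congr' ?_
    filter_upwards [eventually_gt_atTop 0] with n hn
    rw [← mul_assoc, ENNReal.inv_mul_cancel (by simpa using hn.ne') (by simp), one_mul]
  have h2 : Tendsto (fun n => (n * y n) / (1 + y n)) atTop (𝓝 c) := by
    have h3 : Tendsto (fun n => 1 + y n) atTop (𝓝 (1 + 0)) := tendsto_const_nhds.add hy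
    have := ENNReal.Tendsto.div h (.inr (by simp)) h3 (.inl (by simp))
    simpa using this
  refine tendsto_of_tendsto_of_tendsto_of_le_of_le h2 h (fun n => ?_) fun n =>
    mul_le_mul_right (one_sub_expNeg_le _) _
  dsimp only
  rw [mul_div_assoc]
  exact mul_le_mul_right (div_le_one_sub_expNeg _) _

lemma tendsto_natCast_mul_one_sub_expNeg_inv_mul (k : ℝ≥0∞) :
    Tendsto (fun n : ℕ => (n : ℝ≥0∞) * (1 - expNeg ((n : ℝ≥0∞)⁻¹ * k))) atTop (𝓝 k) := by
  rcases eq_or_ne k ∞ with rfl | hk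
  · simp_rw [ENNReal.mul_top (ENNReal.inv_ne_zero.2 (ENNReal.natCast_ne_top _)), expNeg_top]
    simpa using ENNReal.tendsto_nat_nhds_top
  · refine tendsto_natCast_mul_one_sub_expNeg hk (tendsto_const_nhds.congr' ?_)
    filter_upwards [eventually_gt_atTop 0] with n hn
    rw [← mul_assoc, ENNReal.mul_inv_cancel (by simpa using hn.ne') (by simp), one_mul]

section Campbell

variable {E Ω : Type*} [MeasurableSpace E] [mΩ : MeasurableSpace Ω] {P : Measure Ω}
  {μ : Measure E} {Φ : Ω → Set E}

lemma tsum_indicator_one_eq_encard (S : Set E) {B : Set E} (hB : MeasurableSet B) :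
    ∑' x : S, B.indicator (1 : E → ℝ≥0∞) x = (S ∩ B).encard := by
  rw [← lintegral_pointMeasure _ (measurable_one.indicator hB), lintegral_indicator_one hB,
    pointMeasure_apply _ hB]

lemma measurable_encard (h : IsPoissonProcess P μ Φ) {B : Set E} (hB : MeasurableSet B) :
    Measurable fun ω => ((Φ ω ∩ B).encard : ℝ≥0∞) :=
  (measurable_from_top (f := ENat.toENNReal)).comp (h.measurable_count _ hB)

lemma IsPoissonProcess.lintegral_difference_quotient (h : IsPoissonProcess P μ Φ)
    [IsProbabilityMeasure P] [SigmaFinite μ] {B : Set E} (hB : MeasurableSet B)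
    {u : E → ℝ≥0∞} (hu : Measurable u) (n : ℕ) :
    ∫⁻ ω, n * (1 - expNeg ((n : ℝ≥0∞)⁻¹ * (Φ ω ∩ B).encard)) * expNeg (∑' x : Φ ω, u x) ∂P =
      n * (1 - expNeg ((1 - expNeg (n : ℝ≥0∞)⁻¹) * ∫⁻ x in B, expNeg (u x) ∂μ)) *
        expNeg (∫⁻ x, (1 - expNeg (u x)) ∂μ) := by
  set θ : ℝ≥0∞ := (n : ℝ≥0∞)⁻¹
  have hmB := measurable_encard h hB
  have hmu := h.measurable_tsum hu
  let u' : E → ℝ≥0∞ := fun x => u x + θ * B.indicator 1 x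
  have hu' : Measurable u' := hu.add ((measurable_one.indicator hB).const_mul _)
  have h1 (ω : Ω) : expNeg (∑' x : Φ ω, u' x) =
      expNeg (θ * (Φ ω ∩ B).encard) * expNeg (∑' x : Φ ω, u x) := by
    simp only [u']
    rw [ENNReal.tsum_add, ENNReal.tsum_mul_left, tsum_indicator_one_eq_encard _ hB, expNeg_add,
      mul_comm]
  have h2 : ∫⁻ x, (1 - expNeg (u' x)) ∂μ =
      ∫⁻ x, (1 - expNeg (u x)) ∂μ + (1 - expNeg θ) * ∫⁻ x in B, expNeg (u x) ∂μ := by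
    rw [← lintegral_const_mul _ (by fun_prop), ← lintegral_indicator hB,
      ← lintegral_add_left (by fun_prop)]
    refine lintegral_congr fun x => ?_
    by_cases hx : x ∈ B
    · simp only [u', indicator_of_mem hx, Pi.one_apply, mul_one, expNeg_add]
      rw [ENNReal.sub_mul (fun _ _ => expNeg_ne_top _), one_mul, mul_comm (expNeg θ),
        tsub_add_tsub_cancel (expNeg_le_one _)]
      exact mul_le_of_le_one_right' (expNeg_le_one _)
    · simp [u', indicator_of_notMem hx]
  have hL := h.laplace hu
  have hL' := h.laplace hu'
  simp_rw [h1, h2, expNeg_add] at hL'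
  simp_rw [mul_assoc, ENNReal.sub_mul (fun _ _ => expNeg_ne_top _), one_mul]
  rw [lintegral_const_mul _ (by fun_prop), lintegral_sub (by fun_prop), hL, hL']
  · rw [mul_comm (expNeg (∫⁻ x, (1 - expNeg (u x)) ∂μ))]
  · rw [hL']
    exact ENNReal.mul_ne_top (expNeg_ne_top _) (expNeg_ne_top _)
  · exact ae_of_all _ fun ω => mul_le_of_le_one_left' (expNeg_le_one _)

lemma setLIntegral_expNeg_ne_top {B : Set E} (hμ : μ B ≠ ∞) (u : E → ℝ≥0∞) :
    ∫⁻ x in B, expNeg (u x) ∂μ ≠ ∞ := by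
  refine ne_top_of_le_ne_top hμ ?_
  calc ∫⁻ x in B, expNeg (u x) ∂μ ≤ ∫⁻ _ in B, 1 ∂μ := lintegral_mono fun x => expNeg_le_one _
    _ = μ B := by simp

lemma IsPoissonProcess.tendsto_difference_quotient [SigmaFinite μ] {B : Set E} (hμ : μ B ≠ ∞)
    (u : E → ℝ≥0∞) (a : ℝ≥0∞) (ha : a ≠ ∞) :
    Tendsto (fun n : ℕ => n * (1 - expNeg ((1 - expNeg (n : ℝ≥0∞)⁻¹) *
      ∫⁻ x in B, expNeg (u x) ∂μ)) * a) atTop (𝓝 ((∫⁻ x in B, expNeg (u x) ∂μ) * a)) := by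
  refine ENNReal.Tendsto.mul_const ?_ (.inr ha)
  refine tendsto_natCast_mul_one_sub_expNeg (setLIntegral_expNeg_ne_top hμ u) ?_
  simp_rw [← mul_assoc]
  have := tendsto_natCast_mul_one_sub_expNeg_inv_mul 1
  simp_rw [mul_one] at this
  simpa using ENNReal.Tendsto.mul_const this (.inl one_ne_zero)

lemma IsPoissonProcess.lintegral_encard_le (h : IsPoissonProcess P μ Φ)
    [IsProbabilityMeasure P] [SigmaFinite μ] {B : Set E} (hB : MeasurableSet B) (hμ : μ B ≠ ∞) :
    ∫⁻ ω, (Φ ω ∩ B).encard ∂P ≤ μ B := by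
  have h1 := IsPoissonProcess.tendsto_difference_quotient hμ (fun _ => 0) 1 ENNReal.one_ne_top
  have h2 (n : ℕ) := h.lintegral_difference_quotient hB (u := fun _ => 0) measurable_const n
  simp only [expNeg_zero, tsub_self, lintegral_zero, mul_one, tsum_zero, lintegral_const,
    Measure.restrict_apply_univ, one_mul] at h1 h2
  simp_rw [← h2] at h1
  calc ∫⁻ ω, (Φ ω ∩ B).encard ∂P
      = ∫⁻ ω, liminf (fun n : ℕ => n * (1 - expNeg ((n : ℝ≥0∞)⁻¹ * (Φ ω ∩ B).encard))) atTop ∂P :=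
        lintegral_congr fun ω => (tendsto_natCast_mul_one_sub_expNeg_inv_mul _).liminf_eq.symm
    _ ≤ liminf (fun n : ℕ => ∫⁻ ω, n * (1 - expNeg ((n : ℝ≥0∞)⁻¹ * (Φ ω ∩ B).encard)) ∂P) atTop := by
        refine lintegral_liminf_le fun n => ?_
        have := measurable_encard h hB
        fun_prop
    _ = μ B := h1.liminf_eq

lemma IsPoissonProcess.lintegral_encard_mul_expNeg (h : IsPoissonProcess P μ Φ)
    [IsProbabilityMeasure P] [SigmaFinite μ] {B : Set E} (hB : MeasurableSet B) (hμ : μ B ≠ ∞)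
    {u : E → ℝ≥0∞} (hu : Measurable u) :
    ∫⁻ ω, (Φ ω ∩ B).encard * expNeg (∑' x : Φ ω, u x) ∂P =
      (∫⁻ x in B, expNeg (u x) ∂μ) * ∫⁻ ω, expNeg (∑' x : Φ ω, u x) ∂P := by
  have hmB := measurable_encard h hB
  have hmu := h.measurable_tsum hu
  rw [h.laplace hu]
  have h1 := IsPoissonProcess.tendsto_difference_quotient hμ u _
    (expNeg_ne_top (∫⁻ x, (1 - expNeg (u x)) ∂μ))
  simp_rw [← h.lintegral_difference_quotient hB hu] at h1
  refine tendsto_nhds_unique ?_ h1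
  refine tendsto_lintegral_of_dominated_convergence (fun ω => (Φ ω ∩ B).encard)
    (fun n => by fun_prop) (fun n => ae_of_all _ fun ω => ?_)
    (ne_top_of_le_ne_top hμ (h.lintegral_encard_le hB hμ)) (ae_of_all _ fun ω =>
      ENNReal.Tendsto.mul_const (tendsto_natCast_mul_one_sub_expNeg_inv_mul _)
        (.inr (expNeg_ne_top _)))
  refine (mul_le_of_le_one_right' (expNeg_le_one _)).trans ?_
  rcases eq_or_ne n 0 with rfl | hn
  · simp
  · refine (mul_le_mul_right (one_sub_expNeg_le _) _).trans ?_
    rw [← mul_assoc, ENNReal.mul_inv_cancel (by simpa using hn) (by simp), one_mul]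

/-- The Campbell–Mecke formula with an exponential functional. -/
theorem IsPoissonProcess.lintegral_tsum_mul_expNeg (h : IsPoissonProcess P μ Φ)
    [IsProbabilityMeasure P] [SigmaFinite μ] {f u : E → ℝ≥0∞} (hf : Measurable f)
    (hu : Measurable u) :
    ∫⁻ ω, (∑' x : Φ ω, f x) * expNeg (∑' x : Φ ω, u x) ∂P =
      (∫⁻ x, f x * expNeg (u x) ∂μ) * ∫⁻ ω, expNeg (∑' x : Φ ω, u x) ∂P := by
  have hmu := h.measurable_tsum hu
  have hk : Measurable fun ω => pointMeasure (Φ ω) :=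
    (measurable_pointMeasure Φ).mono h.countSigma_le le_rfl
  set c := ∫⁻ ω, expNeg (∑' x : Φ ω, u x) ∂P
  have key : (P.withDensity fun ω => expNeg (∑' x : Φ ω, u x)).bind (fun ω => pointMeasure (Φ ω)) =
      c • μ.withDensity fun x => expNeg (u x) := by
    refine (Measure.ext_iff_of_iUnion_eq_univ (iUnion_spanningSets μ)).2 fun n => ?_
    ext B hB
    have hB' := hB.inter (measurableSet_spanningSets μ n)
    have hm1 : Measurable fun ω => pointMeasure (Φ ω) (B ∩ spanningSets μ n) :=
      (Measure.measurable_coe hB').comp hk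
    rw [Measure.restrict_apply hB, Measure.restrict_apply hB, Measure.bind_apply hB' hk.aemeasurable,
      lintegral_withDensity_eq_lintegral_mul _ (by fun_prop) hm1, Measure.smul_apply, withDensity_apply _ hB',
      smul_eq_mul]
    refine Eq.trans ?_ ((h.lintegral_encard_mul_expNeg hB' (measure_ne_top_of_subset
      inter_subset_right (measure_spanningSets_lt_top μ n).ne) hu).trans (mul_comm _ _))
    refine lintegral_congr fun ω => ?_
    rw [Pi.mul_apply, pointMeasure_apply _ hB', mul_comm]
  have hm1 : Measurable fun ω => ∫⁻ x, f x ∂(pointMeasure (Φ ω)) :=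
    (Measure.measurable_lintegral hf).comp hk
  have := congrArg (fun ν => ∫⁻ x, f x ∂ν) key
  simp only [lintegral_smul_measure, smul_eq_mul] at this
  rw [Measure.lintegral_bind hk.aemeasurable hf.aemeasurable,
    lintegral_withDensity_eq_lintegral_mul _ (by fun_prop) hm1,
    lintegral_withDensity_eq_lintegral_mul _ (by fun_prop) hf] at this
  simp only [Pi.mul_apply, lintegral_pointMeasure _ hf] at this
  simp_rw [mul_comm (f _), mul_comm (∑' x : Φ _, f x)]
  rw [this, mul_comm]

/-- A Poisson process is almost surely given by an s-finite kernel. -/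
lemma IsPoissonProcess.exists_kernel (h : IsPoissonProcess P μ Φ)
    [IsProbabilityMeasure P] [SigmaFinite μ] :
    ∃ κ : Kernel Ω E, IsSFiniteKernel κ ∧ ∀ᵐ ω ∂P, κ ω = pointMeasure (Φ ω) := by
  classical
  have hk : Measurable fun ω => pointMeasure (Φ ω) :=
    (measurable_pointMeasure Φ).mono h.countSigma_le le_rfl
  let κ₀ : Kernel Ω E := ⟨fun ω => pointMeasure (Φ ω), hk⟩
  let D : ℕ → Set E := disjointed (spanningSets μ)
  have hD (n : ℕ) : MeasurableSet (D n) := .disjointed (measurableSet_spanningSets μ) n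
  have hs (q : ℕ × ℕ) : MeasurableSet {ω | (Φ ω ∩ D q.1).encard = q.2} :=
    h.measurable_count _ (hD q.1) (measurableSet_singleton _)
  let κ : ℕ × ℕ → Kernel Ω E := fun q => Kernel.piecewise (hs q) (κ₀.restrict (hD q.1)) 0
  have hκ (q : ℕ × ℕ) : IsFiniteKernel (κ q) := by
    refine ⟨q.2, by simp, fun ω => ?_⟩
    simp only [κ, Kernel.piecewise_apply]
    split_ifs with hω
    · rw [Kernel.restrict_apply, Measure.restrict_apply_univ]
      change pointMeasure (Φ ω) _ ≤ _
      rw [pointMeasure_apply _ (hD _)]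
      rw [mem_ofPred_eq] at hω
      rw [hω]
      simp
    · simp
  refine ⟨Kernel.sum κ, inferInstance, ?_⟩
  have hfin : ∀ᵐ ω ∂P, ∀ n, (Φ ω ∩ D n).encard ≠ ⊤ := by
    refine ae_all_iff.2 fun n => ?_
    have hμ : μ (D n) ≠ ∞ := measure_ne_top_of_subset (disjointed_subset _ _)
      (measure_spanningSets_lt_top μ n).ne
    have h1 := ne_top_of_le_ne_top hμ (h.lintegral_encard_le (hD n) hμ)
    filter_upwards [ae_lt_top (measurable_encard h (hD n)) h1] with ω hω hω'
    rw [hω'] at hω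
    simp at hω
  filter_upwards [hfin] with ω hω
  have h1 (n : ℕ) : Measure.sum (fun j => κ (n, j) ω) = (pointMeasure (Φ ω)).restrict (D n) := by
    ext B hB
    rw [Measure.sum_apply _ hB, tsum_eq_single (Φ ω ∩ D n).encard.toNat]
    · simp only [κ, Kernel.piecewise_apply]
      rw [if_pos (by simpa using (ENat.natCast_toNat (hω n)).symm), Kernel.restrict_apply]
      rfl
    · intro j hj
      simp only [κ, Kernel.piecewise_apply]
      rw [if_neg]
      · simp
      · intro h'
        rw [mem_ofPred_eq] at h'
        rw [h'] at hj
        simp at hj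
  calc Kernel.sum κ ω = Measure.sum fun n => Measure.sum fun j => κ (n, j) ω := by
        rw [Kernel.sum_apply, Measure.sum_sum]
    _ = Measure.sum fun n => (pointMeasure (Φ ω)).restrict (D n) := by simp_rw [h1]
    _ = pointMeasure (Φ ω) := by
        rw [← Measure.restrict_iUnion (disjoint_disjointed _) hD, iUnion_disjointed,
          iUnion_spanningSets, Measure.restrict_univ]

end Campbell
/-! ## The joint law of a point, the maximum over the other points, and the sum over them -/

section Ext

variable {E : Type*} [MeasurableSpace E]

lemma ext_of_lintegral_Iic_expNeg {Q Q' : Measure (ℝ≥0∞ × ℝ≥0∞)} [IsFiniteMeasure Q]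
    [IsFiniteMeasure Q']
    (h : ∀ (r : ℝ≥0∞) (n : ℕ), ∫⁻ z in Prod.fst ⁻¹' Iic r, expNeg (n * z.2) ∂Q =
      ∫⁻ z in Prod.fst ⁻¹' Iic r, expNeg (n * z.2) ∂Q') : Q = Q' := by
  have h1 (r : ℝ≥0∞) : (Q.restrict (Prod.fst ⁻¹' Iic r)).map Prod.snd =
      (Q'.restrict (Prod.fst ⁻¹' Iic r)).map Prod.snd := by
    refine ext_of_forall_lintegral_expNeg fun n => ?_
    rw [lintegral_map (by fun_prop) measurable_snd, lintegral_map (by fun_prop) measurable_snd, h]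
  have h2 {u : Set ℝ≥0∞} (hu : MeasurableSet u) : (Q.restrict (Prod.snd ⁻¹' u)).map Prod.fst =
      (Q'.restrict (Prod.snd ⁻¹' u)).map Prod.fst := by
    refine Measure.ext_of_Iic _ _ fun r => ?_
    have := congrArg (fun ν => ν u) (h1 r)
    rw [Measure.map_apply measurable_snd hu, Measure.map_apply measurable_snd hu,
      Measure.restrict_apply (measurable_snd hu), Measure.restrict_apply (measurable_snd hu)] at this
    rw [Measure.map_apply measurable_fst measurableSet_Iic,
      Measure.map_apply measurable_fst measurableSet_Iic,
      Measure.restrict_apply (measurable_fst measurableSet_Iic),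
      Measure.restrict_apply (measurable_fst measurableSet_Iic), inter_comm, this, inter_comm]
  refine Measure.ext_prod fun {t u} ht hu => ?_
  have := congrArg (fun ν => ν t) (h2 hu)
  rwa [Measure.map_apply measurable_fst ht, Measure.map_apply measurable_fst ht,
    Measure.restrict_apply (measurable_fst ht), Measure.restrict_apply (measurable_fst ht)] at this

lemma ext_of_lintegral_indicator_expNeg {Q Q' : Measure (E × ℝ≥0∞ × ℝ≥0∞)} {S : ℕ → Set E}
    (hS : ∀ i, MeasurableSet (S i)) (hU : ⋃ i, S i = univ)
    (hfin : ∀ i, Q (Prod.fst ⁻¹' S i) ≠ ∞)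
    (h : ∀ i, ∀ B ⊆ S i, MeasurableSet B → ∀ (r : ℝ≥0∞) (n : ℕ),
      ∫⁻ z, B.indicator 1 z.1 * ((Iic r).indicator 1 z.2.1 * expNeg (n * z.2.2)) ∂Q =
      ∫⁻ z, B.indicator 1 z.1 * ((Iic r).indicator 1 z.2.1 * expNeg (n * z.2.2)) ∂Q') :
    Q = Q' := by
  have hrw (B : Set E) (hB : MeasurableSet B) (r : ℝ≥0∞) (n : ℕ) (ν : Measure (E × ℝ≥0∞ × ℝ≥0∞)) :
      ∫⁻ z, B.indicator 1 z.1 * ((Iic r).indicator 1 z.2.1 * expNeg (n * z.2.2)) ∂ν =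
      ∫⁻ z in Prod.fst ⁻¹' Iic r, expNeg (n * z.2)
        ∂((ν.restrict (Prod.fst ⁻¹' B)).map Prod.snd) := by
    rw [setLIntegral_map (measurable_fst measurableSet_Iic) (by fun_prop) measurable_snd,
      Measure.restrict_restrict (measurable_snd (measurable_fst measurableSet_Iic)),
      ← lintegral_indicator ((measurable_snd (measurable_fst measurableSet_Iic)).inter
        (measurable_fst hB))]
    refine lintegral_congr fun z => ?_
    by_cases h1 : z.1 ∈ B <;> by_cases h2 : z.2.1 ≤ r <;> simp [h1, h2, indicator]
  have hfin' (i : ℕ) : Q' (Prod.fst ⁻¹' S i) ≠ ∞ := by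
    have := h i (S i) subset_rfl (hS i) ∞ 0
    rw [hrw _ (hS i), hrw _ (hS i)] at this
    simp only [Iic_top, preimage_univ, Measure.restrict_univ, CharP.cast_eq_zero, zero_mul,
      expNeg_zero, lintegral_const, one_mul] at this
    rw [Measure.map_apply measurable_snd .univ, Measure.map_apply measurable_snd .univ] at this
    simp only [preimage_univ, Measure.restrict_apply_univ] at this
    exact this ▸ hfin i
  have key (i : ℕ) (B : Set E) (hBS : B ⊆ S i) (hB : MeasurableSet B) :
      (Q.restrict (Prod.fst ⁻¹' B)).map Prod.snd = (Q'.restrict (Prod.fst ⁻¹' B)).map Prod.snd := by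
    have : Fact (Q (Prod.fst ⁻¹' B) < ∞) :=
      ⟨(measure_mono (preimage_mono hBS)).trans_lt (hfin i).lt_top⟩
    have : Fact (Q' (Prod.fst ⁻¹' B) < ∞) :=
      ⟨(measure_mono (preimage_mono hBS)).trans_lt (hfin' i).lt_top⟩
    refine ext_of_lintegral_Iic_expNeg fun r n => ?_
    rw [← hrw B hB, ← hrw B hB, h i B hBS hB]
  refine (Measure.ext_iff_of_iUnion_eq_univ (s := fun i => Prod.fst ⁻¹' S i)
    (by rw [← preimage_iUnion, hU, preimage_univ])).2 fun i => ?_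
  have : Fact (Q (Prod.fst ⁻¹' S i) < ∞) := ⟨(hfin i).lt_top⟩
  refine Measure.ext_prod fun {s t} hs ht => ?_
  have hp := hs.prod ht
  rw [Measure.restrict_apply hp, Measure.restrict_apply hp]
  have := congrArg (fun ν => ν t) (key i (s ∩ S i) inter_subset_right (hs.inter (hS i)))
  rw [Measure.map_apply measurable_snd ht, Measure.map_apply measurable_snd ht,
    Measure.restrict_apply (measurable_snd ht), Measure.restrict_apply (measurable_snd ht)] at this
  convert this using 2 <;>
  · ext z
    simp only [mem_inter_iff, mem_prod, mem_preimage]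
    tauto

end Ext

section Mecke

variable {E : Type*}

lemma tsum_points_eq_add {S : Set E} {x : E} (hx : x ∈ S) (u : E → ℝ≥0∞) :
    ∑' y : S, u y = u x + ∑' y : ↥(S \ {x}), u y := by
  have h : S = {x} ∪ S \ {x} := by rw [union_sdiff_self, union_eq_self_of_subset_left (by simpa)]
  conv_lhs => rw [h]
  rw [ENNReal.summable.tsum_union_disjoint disjoint_sdiff_right ENNReal.summable]
  simp

lemma tsum_points_sub {S : Set E} {x : E} (hx : x ∈ S) {u : E → ℝ≥0∞} (hu : u x ≠ ∞) :
    ∑' y : S, u y - u x = ∑' y : ↥(S \ {x}), u y := by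
  rw [tsum_points_eq_add hx, ENNReal.add_sub_cancel_left hu]

lemma iSup_points_le_iff (S : Set E) (v : E → ℝ≥0∞) (r : ℝ≥0∞) :
    (⨆ y ∈ S, v y) ≤ r ↔ ∑' y : S, {y | r < v y}.indicator (1 : E → ℝ≥0∞) y = 0 := by
  simp [ENNReal.tsum_eq_zero]

lemma iSup_points_eq (S : Set E) (v : E → ℝ≥0∞) :
    (⨆ y ∈ S, v y) = ⨆ q : ℚ, if ∑' y : S,
      {y | ((q : ℝ).toNNReal : ℝ≥0∞) < v y}.indicator (1 : E → ℝ≥0∞) y = 0 then 0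
        else ((q : ℝ).toNNReal : ℝ≥0∞) := by
  simp_rw [← iSup_points_le_iff]
  apply le_antisymm
  · refine le_of_forall_lt fun c hc => ?_
    obtain ⟨q, -, h1, h2⟩ := ENNReal.lt_iff_exists_rat_btwn.1 hc
    refine h1.trans_le (le_iSup_of_le q ?_)
    rw [if_neg h2.not_ge]
  · refine iSup_le fun q => ?_
    split_ifs with h
    · exact zero_le
    · exact (not_le.1 h).le

lemma tendsto_expNeg_natCast_mul (a : ℝ≥0∞) :
    Tendsto (fun m : ℕ => expNeg (m * a)) atTop (𝓝 (if a = 0 then 1 else 0)) := by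
  split_ifs with h
  · simp [h, expNeg_zero]
  · rw [← expNeg_top]
    refine (continuous_expNeg.tendsto _).comp ?_
    have := ENNReal.Tendsto.mul_const (b := a) ENNReal.tendsto_nat_nhds_top (.inl ENNReal.top_ne_zero)
    rwa [ENNReal.top_mul h] at this

variable {Ω : Type*} [MeasurableSpace E] {m₁ : MeasurableSpace Ω} [mΩ : MeasurableSpace Ω]
  {P : Measure Ω} {μ : Measure E} {Φ : Ω → Set E}

lemma IsPoissonProcess.measurable_iSup (h : IsPoissonProcess P μ Φ) {v : E → ℝ≥0∞}
    (hv : Measurable v) : Measurable fun ω => ⨆ y ∈ Φ ω, v y := by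
  simp_rw [iSup_points_eq]
  refine Measurable.iSup fun q => Measurable.ite ?_ measurable_const measurable_const
  exact h.measurable_tsum (measurable_one.indicator (measurableSet_lt measurable_const hv))
    (measurableSet_singleton 0)

lemma IsPoissonProcess.lintegral_mul_tsum_mul_expNeg (h : IsPoissonProcess P μ Φ)
    [IsProbabilityMeasure P] [SigmaFinite μ] (hm₁ : m₁ ≤ mΩ)
    (hind : Indep m₁ (countSigma Φ) P) {Y : Ω → ℝ≥0∞} (hY : Measurable[m₁] Y)
    {f u : E → ℝ≥0∞} (hf : Measurable f) (hu : Measurable u) (hu' : ∀ x, u x ≠ ∞) :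
    ∫⁻ ω, Y ω * ∑' x : Φ ω, f x * expNeg (∑' y : ↥(Φ ω \ {x.1}), u y) ∂P =
      (∫⁻ x, f x ∂μ) * ∫⁻ ω, Y ω * expNeg (∑' x : Φ ω, u x) ∂P := by
  have hfu : Measurable fun x => f x * (expNeg (u x))⁻¹ := by fun_prop
  have h0 (x : E) : expNeg (u x) ≠ 0 := (expNeg_pos (hu' x)).ne'
  have h1 (ω : Ω) : ∑' x : Φ ω, f x * expNeg (∑' y : ↥(Φ ω \ {x.1}), u y) =
      (∑' x : Φ ω, f x * (expNeg (u x))⁻¹) * expNeg (∑' x : Φ ω, u x) := by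
    rw [← ENNReal.tsum_mul_right]
    refine tsum_congr fun x => ?_
    rw [tsum_points_eq_add x.2 u, expNeg_add, mul_assoc, ← mul_assoc (expNeg (u x))⁻¹,
      ENNReal.inv_mul_cancel (h0 _) (expNeg_ne_top _), one_mul]
  simp_rw [h1]
  have hm₂ : Measurable[countSigma Φ] fun ω => expNeg (∑' x : Φ ω, u x) :=
    measurable_expNeg.comp (measurable_tsum_points Φ hu)
  have hm₃ : Measurable[countSigma Φ] fun ω =>
      (∑' x : Φ ω, f x * (expNeg (u x))⁻¹) * expNeg (∑' x : Φ ω, u x) :=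
    (measurable_tsum_points Φ hfu).mul hm₂
  rw [lintegral_mul_eq_lintegral_mul_lintegral_of_independent_measurableSpace hm₁ h.countSigma_le
      hind hY hm₃,
    lintegral_mul_eq_lintegral_mul_lintegral_of_independent_measurableSpace hm₁ h.countSigma_le
      hind hY hm₂,
    h.lintegral_tsum_mul_expNeg hfu hu, mul_left_comm]
  congr 3 with x
  rw [mul_assoc, ENNReal.inv_mul_cancel (h0 _) (expNeg_ne_top _), mul_one]

set_option maxHeartbeats 1000000 in
/-- The Mecke formula for functionals of the maximum of `v` and the sum of `p` over the other
points, the latter increased by an independent variable. -/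
theorem IsPoissonProcess.mecke (h : IsPoissonProcess P μ Φ)
    [IsProbabilityMeasure P] [SigmaFinite μ] (hm₁ : m₁ ≤ mΩ)
    (hind : Indep m₁ (countSigma Φ) P) {I : Ω → ℝ≥0∞} (hI : Measurable[m₁] I)
    {p v : E → ℝ≥0∞} (hp : Measurable p) (hp' : ∀ x, p x ≠ ∞) (hv : Measurable v)
    {F : E × ℝ≥0∞ × ℝ≥0∞ → ℝ≥0∞} (hF : Measurable F) :
    AEMeasurable (fun ω => ∑' x : Φ ω,
      F (x, ⨆ y ∈ Φ ω \ {x.1}, v y, ∑' y : ↥(Φ ω \ {x.1}), p y + I ω)) P ∧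
    ∫⁻ ω, ∑' x : Φ ω, F (x, ⨆ y ∈ Φ ω \ {x.1}, v y, ∑' y : ↥(Φ ω \ {x.1}), p y + I ω) ∂P =
      ∫⁻ x, ∫⁻ ω, F (x, ⨆ y ∈ Φ ω, v y, ∑' y : Φ ω, p y + I ω) ∂P ∂μ := by
  obtain ⟨κ, _, hκ⟩ := h.exists_kernel
  have hI' : Measurable I := hI.mono hm₁ le_rfl
  have hsum (G : Ω × E → ℝ≥0∞) (hG : Measurable G) (ω : Ω) (hω : κ ω = pointMeasure (Φ ω)) :
      ∫⁻ x, G (ω, x) ∂(κ ω) = ∑' x : Φ ω, G (ω, x) := by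
    rw [hω, lintegral_pointMeasure _ (by fun_prop)]
  have hC (G : Ω × E → ℝ≥0∞) (hG : Measurable G) :
      ∫⁻ z, G z ∂(P ⊗ₘ κ) = ∫⁻ ω, ∑' x : Φ ω, G (ω, x) ∂P := by
    rw [Measure.lintegral_compProd hG]
    exact lintegral_congr_ae (hκ.mono (hsum G hG))
  let a (r : ℝ≥0∞) : E → ℝ≥0∞ := {y | r < v y}.indicator 1
  have ha (r : ℝ≥0∞) : Measurable (a r) :=
    measurable_one.indicator (measurableSet_lt measurable_const hv)
  have ha' (r : ℝ≥0∞) (x : E) : a r x ≠ ∞ := by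
    simp only [a, indicator]
    split_ifs <;> simp
  let A (r : ℝ≥0∞) : Ω × E → ℝ≥0∞ := fun z => ∑' y : Φ z.1, a r y - a r z.2
  have hA (r : ℝ≥0∞) : Measurable (A r) := by
    have := h.measurable_tsum (ha r)
    exact Measurable.sub (this.comp measurable_fst) ((ha r).comp measurable_snd)
  have hA' (r : ℝ≥0∞) (ω : Ω) (x : Φ ω) : A r (ω, x) = ∑' y : ↥(Φ ω \ {x.1}), a r y :=
    tsum_points_sub x.2 (ha' r x)
  let J : Ω × E → ℝ≥0∞ := fun z => ∑' y : Φ z.1, p y - p z.2 + I z.1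
  have hJ : Measurable J := by
    have := h.measurable_tsum hp
    exact ((this.comp measurable_fst).sub (hp.comp measurable_snd)).add (hI'.comp measurable_fst)
  have hJ' (ω : Ω) (x : Φ ω) : J (ω, x) = ∑' y : ↥(Φ ω \ {x.1}), p y + I ω := by
    simp only [J]
    rw [tsum_points_sub x.2 (hp' x)]
  let M : Ω × E → ℝ≥0∞ := fun z => ⨆ q : ℚ,
    if A ((q : ℝ).toNNReal : ℝ≥0∞) z = 0 then 0 else ((q : ℝ).toNNReal : ℝ≥0∞)
  have hM : Measurable M := Measurable.iSup fun q => Measurable.ite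
    (hA _ (measurableSet_singleton 0)) measurable_const measurable_const
  have hM' (ω : Ω) (x : Φ ω) : M (ω, x) = ⨆ y ∈ Φ ω \ {x.1}, v y := by
    simp only [M, hA']
    exact (iSup_points_eq _ _).symm
  let T : Ω × E → E × ℝ≥0∞ × ℝ≥0∞ := fun z => (z.2, M z, J z)
  have hT : Measurable T := by fun_prop
  let M₀ : Ω → ℝ≥0∞ := fun ω => ⨆ y ∈ Φ ω, v y
  have hM₀ : Measurable M₀ := h.measurable_iSup hv
  let J₀ : Ω → ℝ≥0∞ := fun ω => ∑' y : Φ ω, p y + I ω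
  have hJ₀ : Measurable J₀ := (h.measurable_tsum hp).add hI'
  let T₀ : E × Ω → E × ℝ≥0∞ × ℝ≥0∞ := fun z => (z.1, M₀ z.2, J₀ z.2)
  have hT₀ : Measurable T₀ := by fun_prop
  have hmeas {B : Set E} (hB : MeasurableSet B) (r : ℝ≥0∞) (n : ℕ) :
      Measurable fun z : E × ℝ≥0∞ × ℝ≥0∞ => B.indicator (1 : E → ℝ≥0∞) z.1 *
        ((Iic r).indicator (1 : ℝ≥0∞ → ℝ≥0∞) z.2.1 * expNeg (n * z.2.2)) :=
    ((measurable_one.indicator hB).comp measurable_fst).mul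
      (((measurable_one.indicator measurableSet_Iic).comp (by fun_prop)).mul (by fun_prop))
  have key (B : Set E) (hB : MeasurableSet B) (hμ : μ B ≠ ∞) (r : ℝ≥0∞) (n : ℕ) :
      ∫⁻ z, B.indicator 1 z.1 * ((Iic r).indicator 1 z.2.1 * expNeg (n * z.2.2))
        ∂((P ⊗ₘ κ).map T) =
      μ B * ∫⁻ ω, (Iic r).indicator 1 (M₀ ω) * expNeg (n * J₀ ω) ∂P := by
    have hBm : Measurable (B.indicator (1 : E → ℝ≥0∞)) := measurable_one.indicator hB
    have hsumA := h.measurable_tsum (ha r)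
    have hsump := h.measurable_tsum hp
    have hfin (m : ℕ) : ∫⁻ z, B.indicator 1 z.2 * (expNeg (m * A r z) * expNeg (n * J z)) ∂(P ⊗ₘ κ) =
        μ B * ∫⁻ ω, expNeg (m * ∑' y : Φ ω, a r y) * expNeg (n * J₀ ω) ∂P := by
      rw [hC _ (by fun_prop)]
      let u : E → ℝ≥0∞ := fun x => m * a r x + n * p x
      have hu : Measurable u := by fun_prop
      have hu' (x : E) : u x ≠ ∞ := ENNReal.add_ne_top.2
        ⟨ENNReal.mul_ne_top (by simp) (ha' r x), ENNReal.mul_ne_top (by simp) (hp' x)⟩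
      have hus (S : Set E) : expNeg (∑' y : S, u y) =
          expNeg (m * ∑' y : S, a r y) * expNeg (n * ∑' y : S, p y) := by
        simp only [u]
        rw [ENNReal.tsum_add, ENNReal.tsum_mul_left, ENNReal.tsum_mul_left, expNeg_add]
      have hYm : Measurable[m₁] fun ω => expNeg (n * I ω) :=
        measurable_expNeg.comp (hI.const_mul _)
      have := h.lintegral_mul_tsum_mul_expNeg hm₁ hind hYm hBm hu hu'
      rw [lintegral_indicator_one hB] at this
      refine Eq.trans (lintegral_congr fun ω => ?_) (this.trans (congrArg _
        (lintegral_congr fun ω => ?_)))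
      · rw [← ENNReal.tsum_mul_left]
        refine tsum_congr fun x => ?_
        rw [hus, hA', hJ', mul_add, expNeg_add]
        ring
      · simp only [J₀]
        rw [hus, mul_add, expNeg_add]
        ring
    have h1 : ∫⁻ z, B.indicator 1 z.1 * ((Iic r).indicator 1 z.2.1 * expNeg (n * z.2.2))
        ∂((P ⊗ₘ κ).map T) =
        ∫⁻ z, B.indicator 1 z.2 * ((if A r z = 0 then 1 else 0) * expNeg (n * J z)) ∂(P ⊗ₘ κ) := by
      have hA0 : Measurable fun z => if A r z = 0 then (1 : ℝ≥0∞) else 0 :=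
        Measurable.ite (hA _ (measurableSet_singleton 0)) measurable_const measurable_const
      have hmT : Measurable fun z => B.indicator (1 : E → ℝ≥0∞) (T z).1 *
          ((Iic r).indicator (1 : ℝ≥0∞ → ℝ≥0∞) (T z).2.1 * expNeg (n * (T z).2.2)) :=
        (hmeas hB r n).comp hT
      rw [lintegral_map (hmeas hB r n) hT, hC _ hmT, hC _ (by fun_prop)]
      refine lintegral_congr fun ω => tsum_congr fun x => ?_
      simp only [T]
      congr 2
      rw [hM', hA', indicator_apply]
      simp only [mem_Iic, iSup_points_le_iff, Pi.one_apply]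
      rfl
    have h2 (ω : Ω) : (Iic r).indicator (1 : ℝ≥0∞ → ℝ≥0∞) (M₀ ω) =
        if ∑' y : Φ ω, a r y = 0 then 1 else 0 := by
      rw [indicator_apply]
      simp only [mem_Iic, M₀, iSup_points_le_iff, Pi.one_apply]
      rfl
    simp_rw [h1, h2]
    have hone : ∫⁻ z, B.indicator 1 z.2 ∂(P ⊗ₘ κ) ≠ ∞ := by
      rw [hC _ (by fun_prop)]
      simp_rw [tsum_indicator_one_eq_encard _ hB]
      exact ne_top_of_le_ne_top hμ (h.lintegral_encard_le hB hμ)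
    have h3 : Tendsto (fun m : ℕ =>
        ∫⁻ z, B.indicator 1 z.2 * (expNeg (m * A r z) * expNeg (n * J z)) ∂(P ⊗ₘ κ)) atTop
        (𝓝 (∫⁻ z, B.indicator 1 z.2 *
          ((if A r z = 0 then 1 else 0) * expNeg (n * J z)) ∂(P ⊗ₘ κ))) := by
      refine tendsto_lintegral_of_dominated_convergence (fun z => B.indicator 1 z.2)
        (fun m => by fun_prop) (fun m => ae_of_all _ fun z => mul_le_of_le_one_right'
          (mul_le_one' (expNeg_le_one _) (expNeg_le_one _))) hone (ae_of_all _ fun z => ?_)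
      refine ENNReal.Tendsto.const_mul (ENNReal.Tendsto.mul_const (tendsto_expNeg_natCast_mul _)
        (.inr (expNeg_ne_top _))) (.inr ?_)
      simp only [indicator]
      split_ifs <;> simp
    have h4 : Tendsto (fun m : ℕ =>
        μ B * ∫⁻ ω, expNeg (m * ∑' y : Φ ω, a r y) * expNeg (n * J₀ ω) ∂P) atTop
        (𝓝 (μ B * ∫⁻ ω, (if ∑' y : Φ ω, a r y = 0 then 1 else 0) * expNeg (n * J₀ ω) ∂P)) := by
      refine ENNReal.Tendsto.const_mul ?_ (.inr hμ)
      refine tendsto_lintegral_of_dominated_convergence (fun _ => 1)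
        (fun m => by fun_prop) (fun m => ae_of_all _ fun z =>
          (mul_le_one' (expNeg_le_one _) (expNeg_le_one _))) (by simp) (ae_of_all _ fun z => ?_)
      exact ENNReal.Tendsto.mul_const (tendsto_expNeg_natCast_mul _) (.inr (expNeg_ne_top _))
    simp_rw [hfin] at h3
    exact tendsto_nhds_unique h3 h4
  have hQ : (P ⊗ₘ κ).map T = (μ.prod P).map T₀ := by
    refine ext_of_lintegral_indicator_expNeg (measurableSet_spanningSets μ) (iUnion_spanningSets μ)
      (fun i => ?_) fun i B hBS hB r n => ?_
    · have hm := measurableSet_spanningSets μ i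
      have h1 : Measurable ((spanningSets μ i).indicator (1 : E → ℝ≥0∞)) := measurable_one.indicator hm
      rw [Measure.map_apply hT (measurable_fst hm),
        ← lintegral_indicator_one (hT (measurable_fst hm))]
      change ∫⁻ z : Ω × E, (spanningSets μ i).indicator 1 z.2 ∂_ ≠ ∞
      rw [hC _ (by fun_prop)]
      simp_rw [tsum_indicator_one_eq_encard _ hm]
      exact ne_top_of_le_ne_top (measure_spanningSets_lt_top μ i).ne
        (h.lintegral_encard_le hm (measure_spanningSets_lt_top μ i).ne)
    · have hBm : Measurable (B.indicator (1 : E → ℝ≥0∞)) := measurable_one.indicator hB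
      have hIm : Measurable ((Iic r).indicator (1 : ℝ≥0∞ → ℝ≥0∞)) :=
        measurable_one.indicator measurableSet_Iic
      rw [key B hB (measure_ne_top_of_subset hBS (measure_spanningSets_lt_top μ i).ne),
        lintegral_map (hmeas hB r n) hT₀, ← lintegral_indicator_one hB]
      have hgm : Measurable fun ω => (Iic r).indicator 1 (M₀ ω) * expNeg (n * J₀ ω) := by fun_prop
      exact (lintegral_prod_mul hBm.aemeasurable hgm.aemeasurable).symm
  constructor
  · have hm : Measurable fun ω => ∫⁻ x, F (T (ω, x)) ∂(κ ω) :=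
      Measurable.lintegral_kernel_prod_right' (f := fun z => F (T z)) (hF.comp hT)
    refine ⟨_, hm, hκ.mono fun ω hω => ?_⟩
    dsimp only
    rw [hsum (fun z => F (T z)) (hF.comp hT) ω hω]
    exact tsum_congr fun x => by simp only [T, hM', hJ']
  · calc _ = ∫⁻ z, F z ∂((P ⊗ₘ κ).map T) := by
          rw [lintegral_map hF hT, hC (fun z => F (T z)) (hF.comp hT)]
          exact lintegral_congr fun ω => tsum_congr fun x => by
            simp only [T, hM', hJ']
      _ = _ := by
          rw [hQ, lintegral_map hF hT₀]
          exact lintegral_prod (fun z => F (T₀ z)) (hF.comp hT₀).aemeasurable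

set_option maxHeartbeats 1000000 in
/-- The probability that some point of a Poisson process maximizes `v`, and together with the sum
of `p` over the other points satisfies a given condition. -/
theorem IsPoissonProcess.measure_exists_maximal (h : IsPoissonProcess P μ Φ)
    [IsProbabilityMeasure P] [SigmaFinite μ] (hm₁ : m₁ ≤ mΩ)
    (hind : Indep m₁ (countSigma Φ) P) {I : Ω → ℝ≥0∞} (hI : Measurable[m₁] I)
    {p v : E → ℝ≥0∞} (hp : Measurable p) (hp' : ∀ x, p x ≠ ∞) (hv : Measurable v)
    (hlevel : ∀ c, μ (v ⁻¹' {c}) = 0) {D : Set (E × ℝ≥0∞)} (hD : MeasurableSet D) :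
    NullMeasurableSet {ω | ∃ x ∈ Φ ω, (∀ y ∈ Φ ω, y ≠ x → v y < v x) ∧
      (x, ∑' y : ↥(Φ ω \ {x}), p y + I ω) ∈ D} P ∧
    P {ω | ∃ x ∈ Φ ω, (∀ y ∈ Φ ω, y ≠ x → v y < v x) ∧
      (x, ∑' y : ↥(Φ ω \ {x}), p y + I ω) ∈ D} =
    ∫⁻ x, P {ω | (⨆ y ∈ Φ ω, v y) ≤ v x ∧ (x, ∑' y : Φ ω, p y + I ω) ∈ D} ∂μ := by
  set S := {ω | ∃ x ∈ Φ ω, (∀ y ∈ Φ ω, y ≠ x → v y < v x) ∧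
      (x, ∑' y : ↥(Φ ω \ {x}), p y + I ω) ∈ D} with hS
  have hI' : Measurable I := hI.mono hm₁ le_rfl
  have hM₀ : Measurable fun ω => ⨆ y ∈ Φ ω, v y := h.measurable_iSup hv
  have hJ₀ : Measurable fun ω => ∑' y : Φ ω, p y + I ω := (h.measurable_tsum hp).add hI'
  let D₁ : Set (E × ℝ≥0∞ × ℝ≥0∞) := {z | z.2.1 < v z.1 ∧ (z.1, z.2.2) ∈ D}
  let D₂ : Set (E × ℝ≥0∞ × ℝ≥0∞) := {z | z.2.1 ≤ v z.1 ∧ (z.1, z.2.2) ∈ D}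
  have hD' : MeasurableSet {z : E × ℝ≥0∞ × ℝ≥0∞ | (z.1, z.2.2) ∈ D} :=
    (show Measurable fun z : E × ℝ≥0∞ × ℝ≥0∞ => (z.1, z.2.2) by fun_prop) hD
  have hD₁ : MeasurableSet D₁ := 
    (show MeasurableSet {z : E × ℝ≥0∞ × ℝ≥0∞ | z.2.1 < v z.1} from
      measurableSet_lt (by fun_prop) (by fun_prop)).inter hD'
  have hD₂ : MeasurableSet D₂ := 
    (show MeasurableSet {z : E × ℝ≥0∞ × ℝ≥0∞ | z.2.1 ≤ v z.1} from
      measurableSet_le (by fun_prop) (by fun_prop)).inter hD'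
  have hF₁ : Measurable (D₁.indicator (1 : E × ℝ≥0∞ × ℝ≥0∞ → ℝ≥0∞)) := measurable_one.indicator hD₁
  have hF₂ : Measurable (D₂.indicator (1 : E × ℝ≥0∞ × ℝ≥0∞ → ℝ≥0∞)) := measurable_one.indicator hD₂
  obtain ⟨hm₁', he₁⟩ := h.mecke hm₁ hind hI hp hp' hv hF₁
  obtain ⟨hm₂', he₂⟩ := h.mecke hm₁ hind hI hp hp' hv hF₂
  set t₁ := fun ω => ∑' x : Φ ω, D₁.indicator (1 : E × ℝ≥0∞ × ℝ≥0∞ → ℝ≥0∞)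
    (x, ⨆ y ∈ Φ ω \ {x.1}, v y, ∑' y : ↥(Φ ω \ {x.1}), p y + I ω) with ht₁
  set t₂ := fun ω => ∑' x : Φ ω, D₂.indicator (1 : E × ℝ≥0∞ × ℝ≥0∞ → ℝ≥0∞)
    (x, ⨆ y ∈ Φ ω \ {x.1}, v y, ∑' y : ↥(Φ ω \ {x.1}), p y + I ω) with ht₂
  have hle₁ (ω : Ω) : t₁ ω ≤ S.indicator 1 ω := by
    by_cases hω : ∃ x : Φ ω, (x.1, ⨆ y ∈ Φ ω \ {x.1}, v y, ∑' y : ↥(Φ ω \ {x.1}), p y + I ω) ∈ D₁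
    · obtain ⟨x, hx⟩ := hω
      have hlt (y : E) (hy : y ∈ Φ ω) (hyx : y ≠ x) : v y < v x :=
        (le_iSup₂ (f := fun y (_ : y ∈ Φ ω \ {x.1}) => v y) y ⟨hy, hyx⟩).trans_lt hx.1
      have hωS : ω ∈ S := ⟨x, x.2, hlt, hx.2⟩
      rw [indicator_of_mem hωS, ht₁]
      simp only
      rw [tsum_eq_single x]
      · exact indicator_le_self' (fun _ _ => zero_le_one) _
      · intro y hy
        refine indicator_of_notMem (fun hyD => ?_) _
        have hxy : x.1 ≠ y.1 := fun h => hy (Subtype.ext h.symm)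
        have h1 := (le_iSup₂ (f := fun z (_ : z ∈ Φ ω \ {y.1}) => v z) x.1 ⟨x.2, hxy⟩).trans_lt hyD.1
        exact (h1.trans (hlt y y.2 hxy.symm)).false
    · have : t₁ ω = 0 := by
        rw [ht₁]
        refine ENNReal.tsum_eq_zero.2 fun x => indicator_of_notMem (fun hx => hω ⟨x, hx⟩) _
      rw [this]
      exact zero_le
  have hle₂ (ω : Ω) : S.indicator 1 ω ≤ t₂ ω := by
    by_cases hω : ω ∈ S
    · obtain ⟨x, hx, hlt, hxD⟩ := id hω
      rw [indicator_of_mem hω, ht₂]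
      have hx₂ : (x, ⨆ y ∈ Φ ω \ {x}, v y, ∑' y : ↥(Φ ω \ {x}), p y + I ω) ∈ D₂ :=
        ⟨iSup₂_le fun y hy => (hlt y hy.1 hy.2).le, hxD⟩
      refine le_trans ?_ (ENNReal.le_tsum (⟨x, hx⟩ : Φ ω))
      rw [indicator_of_mem hx₂]
      rfl
    · rw [indicator_of_notMem hω]
      exact zero_le
  have hRHS : ∫⁻ x, ∫⁻ ω, D₁.indicator (1 : E × ℝ≥0∞ × ℝ≥0∞ → ℝ≥0∞)
      (x, ⨆ y ∈ Φ ω, v y, ∑' y : Φ ω, p y + I ω) ∂P ∂μ = ∫⁻ x, ∫⁻ ω, D₂.indicator (1 : E × ℝ≥0∞ × ℝ≥0∞ → ℝ≥0∞)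
      (x, ⨆ y ∈ Φ ω, v y, ∑' y : Φ ω, p y + I ω) ∂P ∂μ := by
    have hpair : Measurable fun z : E × Ω =>
        (z.1, ⨆ y ∈ Φ z.2, v y, ∑' y : Φ z.2, p y + I z.2) :=
      measurable_fst.prodMk ((hM₀.comp measurable_snd).prodMk (hJ₀.comp measurable_snd))
    refine (lintegral_lintegral_swap (f := fun x ω => D₁.indicator 1
        (x, ⨆ y ∈ Φ ω, v y, ∑' y : Φ ω, p y + I ω)) (hF₁.comp hpair).aemeasurable).trans
      (Eq.trans ?_ (lintegral_lintegral_swap (f := fun x ω => D₂.indicator 1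
        (x, ⨆ y ∈ Φ ω, v y, ∑' y : Φ ω, p y + I ω)) (hF₂.comp hpair).aemeasurable).symm)
    refine lintegral_congr fun ω => lintegral_congr_ae ?_
    have : ∀ᵐ x ∂μ, v x ≠ ⨆ y ∈ Φ ω, v y := by
      rw [ae_iff]
      simp only [ne_eq, not_not]
      exact hlevel _
    filter_upwards [this] with x hx
    have hiff : (⨆ y ∈ Φ ω, v y) < v x ↔ (⨆ y ∈ Φ ω, v y) ≤ v x :=
      ⟨le_of_lt, fun h => lt_of_le_of_ne h hx.symm⟩
    classical
    rw [indicator_apply, indicator_apply]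
    exact if_congr (and_congr_left' hiff) rfl rfl
  rw [hRHS] at he₁
  have hval : ∫⁻ x, ∫⁻ ω, D₂.indicator (1 : E × ℝ≥0∞ × ℝ≥0∞ → ℝ≥0∞)
      (x, ⨆ y ∈ Φ ω, v y, ∑' y : Φ ω, p y + I ω) ∂P ∂μ =
      ∫⁻ x, P {ω | (⨆ y ∈ Φ ω, v y) ≤ v x ∧ (x, ∑' y : Φ ω, p y + I ω) ∈ D} ∂μ := by
    refine lintegral_congr fun x => ?_
    have hmx : Measurable fun ω => (x, ⨆ y ∈ Φ ω, v y, ∑' y : Φ ω, p y + I ω) := by fun_prop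
    exact lintegral_indicator_one (hmx hD₂)
  have hae : t₁ =ᵐ[P] t₂ := by
    refine ae_eq_of_ae_le_of_lintegral_le (ae_of_all _ fun ω => (hle₁ ω).trans (hle₂ ω)) ?_ hm₂'
      (he₂.trans he₁.symm).le
    refine ne_top_of_le_ne_top ENNReal.one_ne_top ?_
    calc ∫⁻ ω, t₁ ω ∂P ≤ ∫⁻ _, 1 ∂P := lintegral_mono fun ω =>
          (hle₁ ω).trans (indicator_le_self' (fun _ _ => zero_le_one) _)
      _ = 1 := by simp
  have hS₁ : S.indicator 1 =ᵐ[P] t₁ := by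
    filter_upwards [hae] with ω hω
    exact le_antisymm ((hle₂ ω).trans hω.ge) (hle₁ ω)
  have hnull : NullMeasurableSet S P := by
    have hmS : AEMeasurable (S.indicator (1 : Ω → ℝ≥0∞)) P := hm₁'.congr hS₁.symm
    have : S = S.indicator (1 : Ω → ℝ≥0∞) ⁻¹' {1} := by
      ext ω
      by_cases hω : ω ∈ S <;> simp [hω]
    rw [this]
    exact hmS.nullMeasurable (measurableSet_singleton 1)
  refine ⟨hnull, ?_⟩
  rw [← lintegral_indicator_one₀ hnull, lintegral_congr_ae hS₁, ht₁, he₁, hval]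

end Mecke
/-! ## Exponential gains -/

lemma expMeasure_one_Ioi {x : ℝ} (hx : 0 ≤ x) :
    expMeasure 1 (Ioi x) = ENNReal.ofReal (Real.exp (-x)) := by
  have := isProbabilityMeasure_expMeasure one_pos
  have h1 := cdf_expMeasure_eq one_pos x
  rw [if_pos hx, cdf_eq_real, one_mul] at h1
  rw [← compl_Iic, prob_compl_eq_one_sub measurableSet_Iic, ← ENNReal.ofReal_toReal
    (measure_ne_top (expMeasure 1) (Iic x)), ← ENNReal.ofReal_one,
    ← ENNReal.ofReal_sub _ ENNReal.toReal_nonneg]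
  congr 1
  rw [measureReal_def] at h1
  rw [h1]
  ring

lemma expMeasure_one_sinr {β q : ℝ} (hβ : 0 < β) (hq : 0 < q) (r : ℝ≥0∞) :
    expMeasure 1 {g | ENNReal.ofReal β < ENNReal.ofReal (q * g) / r} =
      expNeg (ENNReal.ofReal (β / q) * r) := by
  rcases eq_or_ne r ∞ with rfl | hr
  · rw [ENNReal.mul_top (by simpa using div_pos hβ hq), expNeg_top]
    simp
  · have hr' : r = ENNReal.ofReal r.toReal := (ENNReal.ofReal_toReal hr).symm
    have h0 : 0 ≤ r.toReal := ENNReal.toReal_nonneg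
    have hset : {g | ENNReal.ofReal β < ENNReal.ofReal (q * g) / r} = Ioi (β / q * r.toReal) := by
      ext g
      rw [mem_ofPred_eq, ENNReal.lt_div_iff_mul_lt (.inr ENNReal.ofReal_ne_top) (.inl hr), hr',
        ← ENNReal.ofReal_mul hβ.le, ENNReal.ofReal_lt_ofReal_iff_of_nonneg (by positivity),
        mem_Ioi, ENNReal.toReal_ofReal h0, div_mul_eq_mul_div, div_lt_iff₀ hq, mul_comm q]
    rw [hset, expMeasure_one_Ioi (by positivity)]
    conv_rhs => rw [hr']
    rw [← ENNReal.ofReal_mul (by positivity), expNeg_ofReal (by positivity)]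

lemma lintegral_expNeg_expMeasure_one {q : ℝ} (hq : 0 ≤ q) :
    ∫⁻ g, expNeg (ENNReal.ofReal (q * g)) ∂(expMeasure 1) = ENNReal.ofReal (1 / (1 + q)) := by
  have h1 : 0 < 1 + q := by linarith
  have hpdf : Measurable fun g => exponentialPDF 1 g := (measurable_exponentialPDFReal 1).ennreal_ofReal
  have hpdf' : Measurable fun g => exponentialPDF (1 + q) g :=
    (measurable_exponentialPDFReal (1 + q)).ennreal_ofReal
  have hm : Measurable fun g : ℝ => expNeg (ENNReal.ofReal (q * g)) := by fun_prop
  change ∫⁻ g, expNeg (ENNReal.ofReal (q * g)) ∂(volume.withDensity fun g => exponentialPDF 1 g) = _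
  rw [lintegral_withDensity_eq_lintegral_mul _ hpdf hm, ← mul_one (ENNReal.ofReal (1 / (1 + q))),
    ← lintegral_exponentialPDF_eq_one h1, ← lintegral_const_mul _ hpdf']
  refine lintegral_congr fun g => ?_
  rw [Pi.mul_apply]
  rcases lt_or_ge g 0 with hg | hg
  · rw [exponentialPDF_of_neg hg, exponentialPDF_of_neg hg, zero_mul, mul_zero]
  · rw [exponentialPDF_of_nonneg hg, exponentialPDF_of_nonneg hg, expNeg_ofReal (by positivity),
      ← ENNReal.ofReal_mul (by positivity), ← ENNReal.ofReal_mul (by positivity), one_mul, one_mul,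
      ← Real.exp_add, ← mul_assoc, one_div, inv_mul_cancel₀ h1.ne', one_mul]
    congr 2
    ring

/-! ## Intensity measures of marked nodes -/

section Intensity

variable {K : ℕ}

/-- The intensity of independently marked nodes of densities `w`, with probability `r l c z` of
environment `c` at `z`, and gains of law `γ c`. -/
noncomputable def nodeIntensity (w : Fin (K + 1) → ℝ≥0)
    (r : Fin (K + 1) → Channel → EuclideanSpace ℝ (Fin 2) → ℝ) (γ : Channel → Measure ℝ) :
    Measure (Node K) :=
  ∑ l : Fin (K + 1), ∑ c : Channel, (w l) •
    (Measure.dirac l).prod ((Measure.dirac c).prod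
      ((volume.withDensity fun z => ENNReal.ofReal (r l c z)).prod (γ c)))

variable {w : Fin (K + 1) → ℝ≥0} {r : Fin (K + 1) → Channel → EuclideanSpace ℝ (Fin 2) → ℝ}
  {γ : Channel → Measure ℝ} [∀ c, IsProbabilityMeasure (γ c)]

lemma sigmaFinite_nodeIntensity : SigmaFinite (nodeIntensity w r γ) := by
  have h1 (l : Fin (K + 1)) (c : Channel) : SigmaFinite ((w l) •
      (Measure.dirac l).prod ((Measure.dirac c).prod
        ((volume.withDensity fun z => ENNReal.ofReal (r l c z)).prod (γ c)))) := inferInstance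
  unfold nodeIntensity
  simp_rw [← Measure.sum_fintype]
  have h2 (l : Fin (K + 1)) := sum.sigmaFinite (fun c : Channel => (w l) •
    (Measure.dirac l).prod ((Measure.dirac c).prod
      ((volume.withDensity fun z => ENNReal.ofReal (r l c z)).prod (γ c))))
  exact sum.sigmaFinite _

lemma lintegral_nodeIntensity (hr : ∀ l c, Measurable (r l c)) {f : Node K → ℝ≥0∞}
    (hf : Measurable f) :
    ∫⁻ x, f x ∂(nodeIntensity w r γ) =
      ∑ l, w l * ∑ c, ∫⁻ z, ENNReal.ofReal (r l c z) * ∫⁻ g, f (l, c, z, g) ∂(γ c) := by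
  unfold nodeIntensity
  rw [lintegral_finsetSum_measure]
  refine Finset.sum_congr rfl fun l _ => ?_
  rw [lintegral_finsetSum_measure, Finset.mul_sum]
  refine Finset.sum_congr rfl fun c _ => ?_
  have hm₁ : Measurable fun y => f (l, y) := hf.comp measurable_prodMk_left
  have hm : Measurable fun y => f (l, c, y) := hm₁.comp measurable_prodMk_left
  rw [lintegral_smul_measure, Measure.dirac_prod, lintegral_map hf measurable_prodMk_left,
    Measure.dirac_prod, lintegral_map hm₁ measurable_prodMk_left, lintegral_prod _ hm.aemeasurable,
    lintegral_withDensity_eq_lintegral_mul _ (hr l c).ennreal_ofReal hm.lintegral_prod_right']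
  rfl

end Intensity

/-! ## Measurability and elementary properties of the model -/

lemma measurable_of_layer_channel {K : ℕ} {β : Type*} [MeasurableSpace β] {f : Node K → β}
    (h : ∀ l c, Measurable fun y : EuclideanSpace ℝ (Fin 2) × ℝ => f (l, c, y)) : Measurable f := by
  have : Measurable (Function.uncurry fun (l : Fin (K + 1))
      (y : Channel × EuclideanSpace ℝ (Fin 2) × ℝ) => f (l, y)) := by
    refine measurable_from_prod_countable_right fun l => ?_
    have : Measurable (Function.uncurry fun (c : Channel)
        (y : EuclideanSpace ℝ (Fin 2) × ℝ) => f (l, c, y)) :=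
      measurable_from_prod_countable_right fun c => h l c
    exact this
  exact this

namespace Network

variable {K : ℕ} (N : Network K)

lemma altDiff_nonneg (i l : Fin (K + 1)) : 0 ≤ N.altDiff i l := abs_nonneg _

lemma dist_nonneg (i l : Fin (K + 1)) (z : EuclideanSpace ℝ (Fin 2)) : 0 ≤ N.dist i l z :=
  Real.sqrt_nonneg _

lemma dist_pos (i l : Fin (K + 1)) {z : EuclideanSpace ℝ (Fin 2)} (hz : z ≠ 0) : 0 < N.dist i l z := by
  have := norm_pos_iff.2 hz
  exact Real.sqrt_pos.2 (by positivity)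

lemma altDiff_le_dist (i l : Fin (K + 1)) (z : EuclideanSpace ℝ (Fin 2)) :
    N.altDiff i l ≤ N.dist i l z :=
  Real.le_sqrt_of_sq_le (by nlinarith [sq_nonneg ‖z‖])

@[fun_prop]
lemma measurable_dist (i l : Fin (K + 1)) : Measurable (N.dist i l) := by
  unfold dist
  fun_prop

lemma measurable_ρ (i l : Fin (K + 1)) (c : Channel) : Measurable (N.ρ i l c) := by
  cases c
  · exact N.ρL_measurable i l
  · exact measurable_const.sub (N.ρL_measurable i l)

lemma ρ_nonneg (i l : Fin (K + 1)) (c : Channel) (x : ℝ) : 0 ≤ N.ρ i l c x := by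
  have := N.ρL_mem i l x
  cases c
  · exact this.1
  · exact sub_nonneg.2 this.2

@[fun_prop]
lemma measurable_ρ_dist (i l : Fin (K + 1)) (c : Channel) :
    Measurable fun z => N.ρ i l c (N.dist i l z) :=
  (N.measurable_ρ i l c).comp (N.measurable_dist i l)

lemma α_pos (c : Channel) : 0 < N.α c := by
  have h1 := N.two_le_α
  have h2 := N.α_le
  cases c <;> linarith

lemma assocValue_nonneg (k : Fin (K + 1)) (a : Criterion) (y : Node K) :
    0 ≤ N.assocValue k a y := by
  obtain ⟨l, c, z, g⟩ := y
  have h1 := (N.bias_pos l).le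
  have h2 := N.dist_nonneg k l z
  cases a
  · exact mul_nonneg h1 (inv_nonneg.2 h2)
  · exact mul_nonneg h1 (Real.rpow_nonneg h2 _)

lemma measurable_assocValue (k : Fin (K + 1)) (a : Criterion) : Measurable (N.assocValue k a) := by
  refine measurable_of_layer_channel fun l c => ?_
  cases a <;>
  · simp only [assocValue]
    fun_prop

lemma assocValue_injective (k l : Fin (K + 1)) (a : Criterion) (c : Channel) (g g' : ℝ)
    {z z' : EuclideanSpace ℝ (Fin 2)} (hz : z ≠ 0) (hz' : z' ≠ 0)
    (h : N.assocValue k a (l, c, z, g) = N.assocValue k a (l, c, z', g')) : ‖z‖ = ‖z'‖ := by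
  have hd : N.dist k l z = N.dist k l z' := by
    have hb := (N.bias_pos l).ne'
    cases a
    · exact inv_injective (mul_left_cancel₀ hb h)
    · have h1 := mul_left_cancel₀ hb h
      exact Real.rpow_left_injOn (neg_ne_zero.2 (N.α_pos c).ne') (N.dist_pos k l hz).le
        (N.dist_pos k l hz').le h1
  rw [dist, dist, Real.sqrt_inj (by positivity) (by positivity)] at hd
  exact (sq_eq_sq₀ (norm_nonneg _) (norm_nonneg _)).1 (by linarith)

/-- The association value as an extended nonnegative real. -/
noncomputable def assocVal (k : Fin (K + 1)) (a : Criterion) (y : Node K) : ℝ≥0∞ :=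
  ENNReal.ofReal (N.assocValue k a y)

lemma measurable_assocVal (k : Fin (K + 1)) (a : Criterion) : Measurable (N.assocVal k a) :=
  (N.measurable_assocValue k a).ennreal_ofReal

lemma assocVal_lt_iff (k : Fin (K + 1)) (a : Criterion) (x y : Node K) :
    N.assocVal k a x < N.assocVal k a y ↔ N.assocValue k a x < N.assocValue k a y :=
  ENNReal.ofReal_lt_ofReal_iff_of_nonneg (N.assocValue_nonneg k a x)

lemma assocVal_gain (k : Fin (K + 1)) (a : Criterion) (l : Fin (K + 1)) (c : Channel)
    (z : EuclideanSpace ℝ (Fin 2)) (g g' : ℝ) :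
    N.assocVal k a (l, c, z, g) = N.assocVal k a (l, c, z, g') := by
  cases a <;> rfl

lemma volume_assocVal_eq (k : Fin (K + 1)) (a : Criterion) (l : Fin (K + 1)) (c : Channel)
    (g : ℝ) (b : ℝ≥0∞) : volume {z | N.assocVal k a (l, c, z, g) = b} = 0 := by
  by_cases h : ∃ z₀, z₀ ≠ 0 ∧ N.assocVal k a (l, c, z₀, g) = b
  · obtain ⟨z₀, hz₀, h₀⟩ := h
    refine measure_mono_null (t := {0} ∪ Metric.sphere 0 ‖z₀‖) (fun z hz => ?_)
      (measure_union_null (measure_singleton _) (Measure.addHaar_sphere _ _ _))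
    by_cases h0 : z = 0
    · exact .inl h0
    · refine .inr (mem_sphere_zero_iff_norm.2 (N.assocValue_injective k l a c g g h0 hz₀ ?_))
      have h1 : N.assocVal k a (l, c, z, g) = N.assocVal k a (l, c, z₀, g) := hz.trans h₀.symm
      exact (ENNReal.ofReal_eq_ofReal_iff (N.assocValue_nonneg k a _) (N.assocValue_nonneg k a _)).1 h1
  · push Not at h
    refine measure_mono_null (t := {0}) (fun z hz => ?_) (measure_singleton _)
    by_contra h0
    exact h z h0 hz

lemma nodeIntensity_assocVal_eq {w : Fin (K + 1) → ℝ≥0}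
    {r : Fin (K + 1) → Channel → EuclideanSpace ℝ (Fin 2) → ℝ}
    {γ : Channel → Measure ℝ} [∀ c, IsProbabilityMeasure (γ c)] (hr : ∀ l c, Measurable (r l c))
    (k : Fin (K + 1)) (a : Criterion) (b : ℝ≥0∞) :
    nodeIntensity w r γ (N.assocVal k a ⁻¹' {b}) = 0 := by
  have hm := N.measurable_assocVal k a (measurableSet_singleton b)
  rw [← lintegral_indicator_one hm, lintegral_nodeIntensity hr (measurable_one.indicator hm)]
  refine Finset.sum_eq_zero fun l _ => mul_eq_zero_of_right _ (Finset.sum_eq_zero fun c _ => ?_)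
  have h0 : ∀ᵐ z, N.assocVal k a (l, c, z, 0) ≠ b := by
    rw [ae_iff]
    simp only [ne_eq, not_not]
    exact N.volume_assocVal_eq k a l c 0 b
  rw [← lintegral_zero (μ := (volume : Measure (EuclideanSpace ℝ (Fin 2))))]
  refine lintegral_congr_ae ?_
  filter_upwards [h0] with z hz
  refine mul_eq_zero_of_right _ ?_
  rw [← lintegral_zero (μ := γ c)]
  refine lintegral_congr fun g => indicator_of_notMem (fun hg => hz ?_) _
  rw [N.assocVal_gain k a l c z 0 g]
  exact hg

/-- The power that a receiver of layer `i` receives from a node. -/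
noncomputable def nodePower (i : Fin (K + 1)) (y : Node K) : ℝ≥0∞ :=
  N.rxPower y.1 y.2.1 (N.dist i y.1 y.2.2.1) y.2.2.2

lemma nodePower_ne_top (i : Fin (K + 1)) (y : Node K) : N.nodePower i y ≠ ∞ := ENNReal.ofReal_ne_top

lemma measurable_nodePower (i : Fin (K + 1)) : Measurable (N.nodePower i) := by
  refine measurable_of_layer_channel fun l c => ?_
  simp only [nodePower, rxPower]
  fun_prop

/-- The Laplace variable of a link of environment `c` to a receiver of layer `i` from a transmitter
of layer `l` at displacement `z`. -/
noncomputable def linkCoeff (i l : Fin (K + 1)) (c : Channel) (z : EuclideanSpace ℝ (Fin 2)) : ℝ≥0∞ :=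
  ENNReal.ofReal (N.β i l / (N.power l * N.dist i l z ^ (-N.α c)))

@[fun_prop]
lemma measurable_linkCoeff (i l : Fin (K + 1)) (c : Channel) : Measurable (N.linkCoeff i l c) := by
  unfold linkCoeff
  fun_prop

lemma gainLaw_eq (hm : ∀ c, N.m c = 1) (c : Channel) : N.gainLaw c = expMeasure 1 := by
  simp [gainLaw, hm, expMeasure]

lemma isProbabilityMeasure_gainLaw (c : Channel) : IsProbabilityMeasure (N.gainLaw c) := by
  have := N.one_le_m c
  have h : (0 : ℝ) < N.m c := by positivity
  exact isProbabilityMeasure_gammaMeasure h h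

lemma gainLaw_sinr (hm : ∀ c, N.m c = 1) (i l : Fin (K + 1)) (c : Channel)
    {z : EuclideanSpace ℝ (Fin 2)} (hz : z ≠ 0) (r : ℝ≥0∞) :
    N.gainLaw c {g | ENNReal.ofReal (N.β i l) < N.rxPower l c (N.dist i l z) g / r} =
      expNeg (N.linkCoeff i l c z * r) := by
  have h1 := N.dist_pos i l hz
  have h2 := N.power_pos l
  rw [N.gainLaw_eq hm, linkCoeff, ← expMeasure_one_sinr (N.β_pos i l)
    (mul_pos h2 (Real.rpow_pos_of_pos h1 _))]
  simp only [rxPower, mul_right_comm]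

/-- The rate at which the density of layer `l` attenuates the Laplace functional at `u` of the
transmitters seen from a receiver of layer `i`. -/
noncomputable def attenuation (i : Fin (K + 1)) (u : Node K → ℝ≥0∞) (l : Fin (K + 1)) : ℝ≥0∞ :=
  ∑ c, ∫⁻ z, ENNReal.ofReal (N.ρ i l c (N.dist i l z)) *
    ∫⁻ g, (1 - expNeg (u (l, c, z, g))) ∂(N.gainLaw c)

lemma lintegral_txIntensity (i : Fin (K + 1)) {u : Node K → ℝ≥0∞} (hu : Measurable u) :
    ∫⁻ y, (1 - expNeg (u y)) ∂(N.txIntensity i) = ∑ l, N.lamTx l * N.attenuation i u l := by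
  have := N.isProbabilityMeasure_gainLaw
  exact lintegral_nodeIntensity (γ := N.gainLaw)
    (r := fun l c z => N.ρ i l c (N.dist i l z)) (fun l c => N.measurable_ρ_dist i l c) (by fun_prop)

/-! ## Success probabilities -/

/-- The condition that the partner `x` of the typical node is in layer `i` and the SINR of the link,
from layer `t` to layer `s`, exceeds its target, in terms of `x` and the interference. -/
def sinrSet (i s t : Fin (K + 1)) : Set (Node K × ℝ≥0∞) :=
  {q | q.1.1 = i ∧ ENNReal.ofReal (N.β s t) <
    N.rxPower t q.1.2.1 (N.dist s t q.1.2.2.1) q.1.2.2.2 / (q.2 + N.noise)}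

lemma measurableSet_sinrSet (i s t : Fin (K + 1)) : MeasurableSet (N.sinrSet i s t) := by
  have h1 : MeasurableSet {q : Node K × ℝ≥0∞ | q.1.1 = i} :=
    (measurable_fst.comp measurable_fst) (measurableSet_singleton i)
  have h2 : Measurable fun y : Node K => N.rxPower t y.2.1 (N.dist s t y.2.2.1) y.2.2.2 := by
    refine measurable_of_layer_channel fun l c => ?_
    simp only [rxPower]
    fun_prop
  have h3 : Measurable fun q : Node K × ℝ≥0∞ =>
      N.rxPower t q.1.2.1 (N.dist s t q.1.2.2.1) q.1.2.2.2 / (q.2 + N.noise) :=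
    (h2.comp measurable_fst).div (measurable_snd.add measurable_const)
  exact h1.inter (measurableSet_lt measurable_const h3)

lemma lintegral_measure_le_assocVal_sinrSet (hm : ∀ c, N.m c = 1) (k : Fin (K + 1)) (a : Criterion)
    (i s t : Fin (K + 1)) {w : Fin (K + 1) → ℝ≥0}
    {r : Fin (K + 1) → Channel → EuclideanSpace ℝ (Fin 2) → ℝ} (hr : ∀ l c, Measurable (r l c))
    {Ω : Type*} [MeasurableSpace Ω] {P : Measure Ω} [IsProbabilityMeasure P] {M J : Ω → ℝ≥0∞}
    (hM : Measurable M) (hJ : Measurable J) :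
    ∫⁻ x, P {ω | M ω ≤ N.assocVal k a x ∧ (x, J ω) ∈ N.sinrSet i s t}
        ∂(nodeIntensity w r N.gainLaw) =
      w i * ∑ c, ∫⁻ z, ENNReal.ofReal (r i c z) *
        ∫⁻ ω, (if M ω ≤ N.assocVal k a (i, c, z, 0) then 1 else 0) *
          expNeg (N.linkCoeff s t c z * (J ω + N.noise)) ∂P := by
  have := N.isProbabilityMeasure_gainLaw
  have hv := N.measurable_assocVal k a
  have hS : MeasurableSet {q : Node K × Ω | M q.2 ≤ N.assocVal k a q.1 ∧
      (q.1, J q.2) ∈ N.sinrSet i s t} := by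
    have h1 : MeasurableSet {q : Node K × Ω | M q.2 ≤ N.assocVal k a q.1} :=
      measurableSet_le (hM.comp measurable_snd) (hv.comp measurable_fst)
    have h2 : Measurable fun q : Node K × Ω => (q.1, J q.2) :=
      measurable_fst.prodMk (hJ.comp measurable_snd)
    exact h1.inter (h2 (N.measurableSet_sinrSet i s t))
  have hmeas : Measurable fun x => P {ω | M ω ≤ N.assocVal k a x ∧ (x, J ω) ∈ N.sinrSet i s t} :=
    measurable_measure_prodMk_left hS
  rw [lintegral_nodeIntensity hr hmeas, Finset.sum_eq_single i]
  · congr 1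
    refine Finset.sum_congr rfl fun c _ => lintegral_congr_ae ?_
    have hz : ∀ᵐ z : EuclideanSpace ℝ (Fin 2), z ≠ 0 := by
      rw [ae_iff]
      simp
    filter_upwards [hz] with z hz
    congr 1
    have hT : MeasurableSet {q : ℝ × Ω | M q.2 ≤ N.assocVal k a (i, c, z, q.1) ∧
        ((i, c, z, q.1), J q.2) ∈ N.sinrSet i s t} := by
      have h1 : Measurable fun q : ℝ × Ω => (((i, c, z, q.1) : Node K), q.2) := by fun_prop
      exact h1 hS
    calc ∫⁻ g, P {ω | M ω ≤ N.assocVal k a (i, c, z, g) ∧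
          ((i, c, z, g), J ω) ∈ N.sinrSet i s t} ∂(N.gainLaw c)
        = (N.gainLaw c).prod P {q : ℝ × Ω | M q.2 ≤ N.assocVal k a (i, c, z, q.1) ∧
            ((i, c, z, q.1), J q.2) ∈ N.sinrSet i s t} := (Measure.prod_apply hT).symm
      _ = ∫⁻ ω, N.gainLaw c {g | M ω ≤ N.assocVal k a (i, c, z, g) ∧
            ((i, c, z, g), J ω) ∈ N.sinrSet i s t} ∂P := Measure.prod_apply_symm hT
      _ = _ := by
          refine lintegral_congr fun ω => ?_
          rw [← N.gainLaw_sinr hm s t c hz]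
          have hg (g : ℝ) : N.assocVal k a (i, c, z, g) = N.assocVal k a (i, c, z, 0) :=
            N.assocVal_gain k a i c z g 0
          simp only [hg, sinrSet, mem_ofPred_eq, true_and]
          split_ifs with h <;> simp [h]
  · intro l _ hl
    refine mul_eq_zero_of_right _ (Finset.sum_eq_zero fun c _ => ?_)
    simp [sinrSet, hl]
  · simp

/-- The exponent in the Laplace functional of the interferers at a receiver that is associated with
a transmitter of layer `i`. -/
noncomputable def rxExponent (k : Fin (K + 1)) (a : Criterion) (i : Fin (K + 1)) (c : Channel)
    (z : EuclideanSpace ℝ (Fin 2)) (y : Node K) : ℝ≥0∞ :=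
  ∞ * {y | N.assocVal k a (i, c, z, 0) < N.assocVal k a y}.indicator 1 y +
    N.linkCoeff k i c z * N.nodePower k y

/-- The exponent in the Laplace functional of the interferers at a receiver of layer `i` that is
associated with a transmitter of layer `k`. -/
noncomputable def txExponent (k i : Fin (K + 1)) (c : Channel)
    (z : EuclideanSpace ℝ (Fin 2)) (y : Node K) : ℝ≥0∞ :=
  N.linkCoeff i k c z * N.nodePower i y

lemma measurable_indicator_assocVal (k : Fin (K + 1)) (a : Criterion) (i : Fin (K + 1))
    (c : Channel) :
    Measurable (Function.uncurry fun (z : EuclideanSpace ℝ (Fin 2)) (y : Node K) =>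
      {y | N.assocVal k a (i, c, z, 0) < N.assocVal k a y}.indicator (1 : Node K → ℝ≥0∞) y) := by
  have h1 : Measurable fun z : EuclideanSpace ℝ (Fin 2) => ((i, c, z, 0) : Node K) := by fun_prop
  have h2 : MeasurableSet {q : EuclideanSpace ℝ (Fin 2) × Node K |
      N.assocVal k a (i, c, q.1, 0) < N.assocVal k a q.2} :=
    measurableSet_lt (((N.measurable_assocVal k a).comp h1).comp measurable_fst)
      ((N.measurable_assocVal k a).comp measurable_snd)
  exact measurable_one.indicator h2

lemma measurable_txExponent (k i : Fin (K + 1)) (c : Channel) :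
    Measurable (Function.uncurry (N.txExponent k i c)) := by
  have := N.measurable_nodePower i
  unfold txExponent Function.uncurry
  fun_prop

lemma measurable_rxExponent (k : Fin (K + 1)) (a : Criterion) (i : Fin (K + 1)) (c : Channel) :
    Measurable (Function.uncurry (N.rxExponent k a i c)) :=
  ((N.measurable_indicator_assocVal k a i c).const_mul _).add (N.measurable_txExponent i k c)

lemma rxSuccess_iff (k : Fin (K + 1)) (a : Criterion) (i : Fin (K + 1)) (S : Set (Node K)) :
    N.RxSuccess k a i S ↔ ∃ x ∈ S, (∀ y ∈ S, y ≠ x → N.assocVal k a y < N.assocVal k a x) ∧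
      (x, ∑' y : ↥(S \ {x}), N.nodePower k y + 0) ∈ N.sinrSet i k i := by
  simp only [assocVal_lt_iff, add_zero]
  constructor
  · rintro ⟨c, z, g, ⟨h1, h2⟩, h3⟩
    exact ⟨(i, c, z, g), h1, h2, rfl, h3⟩
  · rintro ⟨⟨l, c, z, g⟩, h1, h2, h3, h4⟩
    obtain rfl : l = i := h3
    exact ⟨c, z, g, ⟨h1, h2⟩, h4⟩

lemma txSuccess_iff (k : Fin (K + 1)) (a : Criterion) (i : Fin (K + 1)) (R : Set (Node K))
    (S : Fin (K + 1) → Set (Node K)) :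
    N.TxSuccess k a i R S ↔ ∃ x ∈ R, (∀ y ∈ R, y ≠ x → N.assocVal k a y < N.assocVal k a x) ∧
      (x, ∑' y : ↥(R \ {x}), (fun _ => 0) y.1 + ∑' y : S i, N.nodePower i y) ∈ N.sinrSet i i k := by
  simp only [assocVal_lt_iff, tsum_zero, zero_add]
  constructor
  · rintro ⟨c, z, g, ⟨h1, h2⟩, h3⟩
    exact ⟨(i, c, z, g), h1, h2, rfl, h3⟩
  · rintro ⟨⟨l, c, z, g⟩, h1, h2, h3, h4⟩
    obtain rfl : l = i := h3
    exact ⟨c, z, g, ⟨h1, h2⟩, h4⟩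

lemma isAssociated_unique {k : Fin (K + 1)} {a : Criterion} {S : Set (Node K)} {x y : Node K}
    (hx : N.IsAssociated k a S x) (hy : N.IsAssociated k a S y) : x = y := by
  by_contra h
  exact lt_asymm (hx.2 y hy.1 (Ne.symm h)) (hy.2 x hx.1 h)

variable {Ω : Type*} [MeasurableSpace Ω] {P : Measure Ω} [IsProbabilityMeasure P]
  {Tx Rx : Fin (K + 1) → Ω → Set (Node K)}

lemma ite_iSup_assocVal_eq (k : Fin (K + 1)) (a : Criterion) (i : Fin (K + 1)) (c : Channel)
    (z : EuclideanSpace ℝ (Fin 2)) (S : Set (Node K)) :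
    (if (⨆ y ∈ S, N.assocVal k a y) ≤ N.assocVal k a (i, c, z, 0) then (1 : ℝ≥0∞) else 0) =
      expNeg (∑' y : S, ∞ *
        {y | N.assocVal k a (i, c, z, 0) < N.assocVal k a y}.indicator 1 y.1) := by
  simp only [iSup_points_le_iff]
  rw [ENNReal.tsum_mul_left]
  split_ifs with h
  · rw [h, mul_zero, expNeg_zero]
  · rw [ENNReal.top_mul h, expNeg_top]

/-- The probability that a receiver of layer `k` is associated with layer `i` and successful. -/
theorem measure_rxSuccess (hm : ∀ c, N.m c = 1) (h : N.IsRealization P Tx Rx) (k : Fin (K + 1))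
    (a : Criterion) (i : Fin (K + 1)) :
    NullMeasurableSet {ω | N.RxSuccess k a i (Tx k ω)} P ∧
    P {ω | N.RxSuccess k a i (Tx k ω)} =
      N.lamTx i * ∑ c, ∫⁻ z, ENNReal.ofReal (N.ρ k i c (N.dist k i z)) *
        expNeg (N.linkCoeff k i c z * N.noise) *
          expNeg (∑ l, N.lamTx l * N.attenuation k (N.rxExponent k a i c z) l) := by
  have := N.isProbabilityMeasure_gainLaw
  have hr (l : Fin (K + 1)) (c : Channel) := N.measurable_ρ_dist k l c
  have hσ : SigmaFinite (N.txIntensity k) :=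
    sigmaFinite_nodeIntensity (r := fun l c z => N.ρ k l c (N.dist k l z))
  have hΦ := h.tx_poisson k
  have key := hΦ.measure_exists_maximal (m₁ := ⊥) bot_le (indep_bot_left _)
    (I := fun _ => 0) measurable_const (N.measurable_nodePower k) (N.nodePower_ne_top k)
    (N.measurable_assocVal k a) (N.nodeIntensity_assocVal_eq hr k a)
    (N.measurableSet_sinrSet i k i)
  have hset : {ω | N.RxSuccess k a i (Tx k ω)} = {ω | ∃ x ∈ Tx k ω,
      (∀ y ∈ Tx k ω, y ≠ x → N.assocVal k a y < N.assocVal k a x) ∧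
        (x, ∑' y : ↥(Tx k ω \ {x}), N.nodePower k y + 0) ∈ N.sinrSet i k i} :=
    Set.ext fun ω => N.rxSuccess_iff k a i (Tx k ω)
  have hint := N.lintegral_measure_le_assocVal_sinrSet hm k a i k i (w := N.lamTx) hr (P := P)
    (hΦ.measurable_iSup (N.measurable_assocVal k a))
    ((hΦ.measurable_tsum (N.measurable_nodePower k)).add_const 0)
  rw [hset]
  refine ⟨key.1, key.2.trans ?_⟩
  refine Eq.trans hint ?_
  refine congrArg (_ * ·) (Finset.sum_congr rfl fun c _ => lintegral_congr fun z => ?_)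
  have hu := (N.measurable_rxExponent k a i c).of_uncurry_left (x := z)
  have hmu : Measurable fun ω => expNeg (∑' y : Tx k ω, N.rxExponent k a i c z y) :=
    measurable_expNeg.comp (hΦ.measurable_tsum hu)
  rw [mul_assoc]
  refine congrArg (_ * ·) ?_
  rw [← N.lintegral_txIntensity k hu, ← hΦ.laplace hu,
    ← lintegral_const_mul _ hmu]
  refine lintegral_congr fun ω => ?_
  have hE : expNeg (∑' y : Tx k ω, N.rxExponent k a i c z y) =
      expNeg (∑' y : Tx k ω, ∞ *
        {y | N.assocVal k a (i, c, z, 0) < N.assocVal k a y}.indicator 1 y.1) *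
      expNeg (N.linkCoeff k i c z * ∑' y : Tx k ω, N.nodePower k y) := by
    rw [← ENNReal.tsum_mul_left, ← expNeg_add, ← ENNReal.tsum_add]
    rfl
  rw [ite_iSup_assocVal_eq, add_zero, mul_add, expNeg_add, hE]
  ring

/-- The probability that no receiver is preferred to one of layer `i` at `z`. -/
noncomputable def assocProb (k : Fin (K + 1)) (a : Criterion) (i : Fin (K + 1)) (c : Channel)
    (z : EuclideanSpace ℝ (Fin 2)) : ℝ≥0∞ :=
  expNeg (∫⁻ y, (1 - expNeg (∞ *
    {y | N.assocVal k a (i, c, z, 0) < N.assocVal k a y}.indicator 1 y)) ∂(N.rxIntensity k))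

/-- The probability that a transmitter of layer `k` is associated with layer `i` and successful. -/
theorem measure_txSuccess (hm : ∀ c, N.m c = 1) (h : N.IsRealization P Tx Rx) (k : Fin (K + 1))
    (a : Criterion) (i : Fin (K + 1)) :
    NullMeasurableSet {ω | N.TxSuccess k a i (Rx k ω) fun l => Tx l ω} P ∧
    P {ω | N.TxSuccess k a i (Rx k ω) fun l => Tx l ω} =
      N.lamRx i * ∑ c, ∫⁻ z, ENNReal.ofReal (N.ρ i k c (N.dist i k z)) *
        (N.assocProb k a i c z * expNeg (N.linkCoeff i k c z * N.noise)) *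
          expNeg (∑ l, N.lamTx l * N.attenuation i (N.txExponent k i c z) l) := by
  have := N.isProbabilityMeasure_gainLaw
  have hr (l : Fin (K + 1)) (c : Channel) := N.measurable_ρ_dist l k c
  have hσ : SigmaFinite (N.rxIntensity k) :=
    sigmaFinite_nodeIntensity (r := fun l c z => N.ρ l k c (N.dist l k z))
  have hσ' : SigmaFinite (N.txIntensity i) :=
    sigmaFinite_nodeIntensity (r := fun l c z => N.ρ i l c (N.dist i l z))
  have hΦ := h.rx_poisson k
  have hΨ := h.tx_poisson i
  have hI := measurable_tsum_points (Tx i) (N.measurable_nodePower i)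
  have key := hΦ.measure_exists_maximal (m₁ := countSigma (Tx i)) hΨ.countSigma_le
    (h.indep k i).symm hI (p := fun _ => 0) measurable_const (fun _ => ENNReal.zero_ne_top)
    (N.measurable_assocVal k a) (N.nodeIntensity_assocVal_eq hr k a)
    (N.measurableSet_sinrSet i i k)
  have hset : {ω | N.TxSuccess k a i (Rx k ω) fun l => Tx l ω} = {ω | ∃ x ∈ Rx k ω,
      (∀ y ∈ Rx k ω, y ≠ x → N.assocVal k a y < N.assocVal k a x) ∧
        (x, ∑' y : ↥(Rx k ω \ {x}), (fun _ => 0) y.1 + ∑' y : Tx i ω, N.nodePower i y) ∈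
          N.sinrSet i i k} :=
    Set.ext fun ω => N.txSuccess_iff k a i (Rx k ω) fun l => Tx l ω
  have hint := N.lintegral_measure_le_assocVal_sinrSet hm k a i i k (w := N.lamRx) hr (P := P)
    (hΦ.measurable_iSup (N.measurable_assocVal k a))
    (J := fun ω => ∑' y : Rx k ω, (fun _ => 0) y.1 + ∑' y : Tx i ω, N.nodePower i y)
    ((hΦ.measurable_tsum (f := fun _ => 0) measurable_const).add
      (hΨ.measurable_tsum (N.measurable_nodePower i)))
  rw [hset]
  refine ⟨key.1, key.2.trans ?_⟩
  refine Eq.trans hint ?_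
  refine congrArg (_ * ·) (Finset.sum_congr rfl fun c _ => lintegral_congr fun z => ?_)
  have hu := (N.measurable_txExponent k i c).of_uncurry_left (x := z)
  have hg : Measurable fun y : Node K => ∞ *
      {y | N.assocVal k a (i, c, z, 0) < N.assocVal k a y}.indicator (1 : Node K → ℝ≥0∞) y :=
    ((N.measurable_indicator_assocVal k a i c).of_uncurry_left (x := z)).const_mul ∞
  have hmu : Measurable[countSigma (Tx i)] fun ω =>
      expNeg (∑' y : Tx i ω, N.txExponent k i c z y) :=
    measurable_expNeg.comp (measurable_tsum_points (Tx i) hu)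
  have hmg : Measurable[countSigma (Rx k)] fun ω => expNeg (∑' y : Rx k ω, ∞ *
      {y | N.assocVal k a (i, c, z, 0) < N.assocVal k a y}.indicator (1 : Node K → ℝ≥0∞) y) :=
    measurable_expNeg.comp (measurable_tsum_points (Rx k) hg)
  have hmgu : Measurable fun ω => expNeg (∑' y : Rx k ω, ∞ *
      {y | N.assocVal k a (i, c, z, 0) < N.assocVal k a y}.indicator (1 : Node K → ℝ≥0∞) y) *
      expNeg (∑' y : Tx i ω, N.txExponent k i c z y) :=
    (hmg.mono hΦ.countSigma_le le_rfl).mul (hmu.mono hΨ.countSigma_le le_rfl)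
  rw [mul_assoc]
  refine congrArg (_ * ·) ?_
  rw [← N.lintegral_txIntensity i hu, ← hΨ.laplace hu, assocProb, ← hΦ.laplace hg, mul_right_comm,
    ← lintegral_mul_eq_lintegral_mul_lintegral_of_independent_measurableSpace hΦ.countSigma_le
      hΨ.countSigma_le (h.indep k i) hmg hmu, mul_comm,
    ← lintegral_const_mul _ hmgu]
  refine lintegral_congr fun ω => ?_
  have hE : expNeg (∑' y : Tx i ω, N.txExponent k i c z y) =
      expNeg (N.linkCoeff i k c z * ∑' y : Tx i ω, N.nodePower i y) := by
    rw [← ENNReal.tsum_mul_left]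
    rfl
  simp only [tsum_zero, zero_add]
  rw [ite_iSup_assocVal_eq, mul_add, expNeg_add, hE]
  ring

end Network
/-! ## Distances to an elevated node -/

lemma map_sqrt_norm_sq_add_Iic {h : ℝ} (hh : 0 ≤ h) (x : ℝ) :
    (volume.map fun z : EuclideanSpace ℝ (Fin 2) => √(‖z‖ ^ 2 + h ^ 2)) (Iic x) =
      ENNReal.ofReal (Real.pi * (max x h ^ 2 - h ^ 2)) := by
  have hm : Measurable fun z : EuclideanSpace ℝ (Fin 2) => √(‖z‖ ^ 2 + h ^ 2) := by fun_prop
  rw [Measure.map_apply hm measurableSet_Iic]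
  rcases lt_or_ge x h with hx | hx
  · rw [max_eq_right hx.le, sub_self, mul_zero, ENNReal.ofReal_zero]
    convert measure_empty (μ := (volume : Measure (EuclideanSpace ℝ (Fin 2))))
    refine eq_empty_of_forall_notMem fun z hz => ?_
    have h1 : h ≤ √(‖z‖ ^ 2 + h ^ 2) := Real.le_sqrt_of_sq_le (by nlinarith [sq_nonneg ‖z‖])
    exact absurd (h1.trans hz) hx.not_ge
  · have h0 : 0 ≤ x := hh.trans hx
    have h2 : 0 ≤ x ^ 2 - h ^ 2 := by nlinarith
    have hset : (fun z : EuclideanSpace ℝ (Fin 2) => √(‖z‖ ^ 2 + h ^ 2)) ⁻¹' Iic x =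
        Metric.closedBall 0 √(x ^ 2 - h ^ 2) := by
      ext z
      rw [mem_preimage, mem_Iic, Real.sqrt_le_left h0, mem_closedBall_zero_iff,
        Real.le_sqrt (norm_nonneg _) h2]
      constructor <;> intro h <;> linarith
    rw [hset, max_eq_left hx, EuclideanSpace.volume_closedBall_fin_two,
      ← ENNReal.ofReal_pow (Real.sqrt_nonneg _), Real.sq_sqrt h2, mul_comm]
    rw [← NNReal.coe_real_pi, ENNReal.ofReal_mul (by positivity), ENNReal.ofReal_coe_nnreal]

lemma withDensity_Ioi_Iic {h : ℝ} (hh : 0 ≤ h) (x : ℝ) :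
    (ENNReal.ofReal (2 * Real.pi) • (volume.restrict (Ioi h)).withDensity ENNReal.ofReal) (Iic x) =
      ENNReal.ofReal (Real.pi * (max x h ^ 2 - h ^ 2)) := by
  rw [Measure.smul_apply, withDensity_apply _ measurableSet_Iic,
    Measure.restrict_restrict measurableSet_Iic, inter_comm, Ioi_inter_Iic, smul_eq_mul]
  rcases lt_or_ge x h with hx | hx
  · rw [Ioc_eq_empty hx.not_gt, max_eq_right hx.le]
    simp
  · rw [← ofReal_integral_eq_lintegral_ofReal, ← intervalIntegral.integral_of_le hx, integral_id,
      ← ENNReal.ofReal_mul (by positivity), max_eq_left hx]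
    · congr 1
      ring
    · exact (continuous_id.integrableOn_Icc (a := h) (b := x)).mono_set Ioc_subset_Icc_self
    · filter_upwards [ae_restrict_mem measurableSet_Ioc] with y hy
      exact hh.trans hy.1.le

lemma map_sqrt_norm_sq_add {h : ℝ} (hh : 0 ≤ h) :
    (volume.map fun z : EuclideanSpace ℝ (Fin 2) => √(‖z‖ ^ 2 + h ^ 2)) =
      ENNReal.ofReal (2 * Real.pi) • (volume.restrict (Ioi h)).withDensity ENNReal.ofReal := by
  have h1 := map_sqrt_norm_sq_add_Iic hh
  have h2 := withDensity_Ioi_Iic hh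
  have hlf : IsLocallyFiniteMeasure
      (volume.map fun z : EuclideanSpace ℝ (Fin 2) => √(‖z‖ ^ 2 + h ^ 2)) :=
    ⟨fun x => ⟨Iic (x + 1), Iic_mem_nhds (by linarith), by rw [h1]; exact ENNReal.ofReal_lt_top⟩⟩
  refine Measure.ext_of_Ioc _ _ fun a b hab => ?_
  rw [← Iic_sdiff_Iic, measure_sdiff (Iic_subset_Iic.2 hab.le) measurableSet_Iic.nullMeasurableSet,
    measure_sdiff (Iic_subset_Iic.2 hab.le) measurableSet_Iic.nullMeasurableSet, h1, h1, h2, h2]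
  · rw [h2]; exact ENNReal.ofReal_ne_top
  · rw [h1]; exact ENNReal.ofReal_ne_top

lemma lintegral_comp_sqrt_norm_sq_add {h : ℝ} (hh : 0 ≤ h) {f : ℝ → ℝ≥0∞} (hf : Measurable f) :
    ∫⁻ z : EuclideanSpace ℝ (Fin 2), f √(‖z‖ ^ 2 + h ^ 2) =
      ENNReal.ofReal (2 * Real.pi) * ∫⁻ x in Ioi h, ENNReal.ofReal x * f x := by
  have hm : Measurable fun z : EuclideanSpace ℝ (Fin 2) => √(‖z‖ ^ 2 + h ^ 2) := by fun_prop
  rw [← lintegral_map hf hm, map_sqrt_norm_sq_add hh, lintegral_smul_measure,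
    lintegral_withDensity_eq_lintegral_mul _ ENNReal.measurable_ofReal hf]
  rfl

/-! ## Bounds on the attenuation -/

namespace Network

variable {K : ℕ} (N : Network K)

lemma sum_channel {M : Type*} [AddCommMonoid M] (f : Channel → M) :
    ∑ c, f c = f .los + f .nlos := by
  change ∑ c ∈ ({.los, .nlos} : Finset Channel), f c = _
  exact Finset.sum_pair (by decide)

lemma attenuation_mono (i l : Fin (K + 1)) {u u' : Node K → ℝ≥0∞} (h : ∀ y, u y ≤ u' y) :
    N.attenuation i u l ≤ N.attenuation i u' l :=
  Finset.sum_le_sum fun _ _ => lintegral_mono fun _ => mul_le_mul_right (lintegral_mono fun _ =>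
    tsub_le_tsub_left (expNeg_antitone (h _)) _) _

lemma attenuation_mul_nodePower (hm : ∀ c, N.m c = 1) (i l : Fin (K + 1)) {s : ℝ} (hs : 0 ≤ s) :
    N.attenuation i (fun y => ENNReal.ofReal s * N.nodePower i y) l =
      ∑ c, ∫⁻ z, ENNReal.ofReal (N.ρ i l c (N.dist i l z) *
        (1 - 1 / (1 + s * (N.power l * N.dist i l z ^ (-N.α c))))) := by
  refine Finset.sum_congr rfl fun c _ => lintegral_congr fun z => ?_
  rw [ENNReal.ofReal_mul (N.ρ_nonneg _ _ _ _)]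
  congr 1
  set q := s * (N.power l * N.dist i l z ^ (-N.α c)) with hq
  have hq0 : 0 ≤ q := mul_nonneg hs (mul_nonneg (N.power_pos l).le
    (Real.rpow_nonneg (N.dist_nonneg i l z) _))
  have h1 (g : ℝ) : ENNReal.ofReal s * N.nodePower i (l, c, z, g) = ENNReal.ofReal (q * g) := by
    rw [nodePower, rxPower, ← ENNReal.ofReal_mul hs]
    congr 1
    rw [hq]
    ring
  have := isProbabilityMeasure_expMeasure one_pos
  simp_rw [h1]
  rw [N.gainLaw_eq hm, lintegral_sub (by fun_prop), lintegral_expNeg_expMeasure_one hq0,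
    lintegral_one, measure_univ, ENNReal.ofReal_sub _ (by positivity), ENNReal.ofReal_one]
  · rw [lintegral_expNeg_expMeasure_one hq0]
    exact ENNReal.ofReal_ne_top
  · exact ae_of_all _ fun g => expNeg_le_one _

lemma attenuation_mul_nodePower_pos (hm : ∀ c, N.m c = 1) (i l : Fin (K + 1)) {s : ℝ}
    (hs : 0 < s) : 0 < N.attenuation i (fun y => ENNReal.ofReal s * N.nodePower i y) l := by
  rw [N.attenuation_mul_nodePower hm i l hs.le, ← lintegral_finsetSum _ fun c _ => by fun_prop]
  rw [lintegral_pos_iff_support (Finset.measurable_sum _ fun c _ => by fun_prop)]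
  refine lt_of_lt_of_le ?_ (measure_mono (s := {0}ᶜ) fun z hz => ?_)
  · rw [measure_compl (measurableSet_singleton _) (by simp)]
    simp
  · have hd := N.dist_pos i l (z := z) hz
    have hq (c : Channel) : 0 < 1 - 1 / (1 + s * (N.power l * N.dist i l z ^ (-N.α c))) := by
      have h1 : 0 < s * (N.power l * N.dist i l z ^ (-N.α c)) :=
        mul_pos hs (mul_pos (N.power_pos l) (Real.rpow_pos_of_pos hd _))
      rw [sub_pos, div_lt_one (by linarith)]
      linarith
    rw [Function.mem_support, sum_channel]
    intro h0
    rw [add_eq_zero, ENNReal.ofReal_eq_zero, ENNReal.ofReal_eq_zero] at h0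
    have h1 : N.ρ i l .los (N.dist i l z) ≤ 0 := by
      by_contra h
      exact absurd h0.1 (not_le.2 (mul_pos (not_le.1 h) (hq _)))
    have h2 : N.ρ i l .nlos (N.dist i l z) ≤ 0 := by
      by_contra h
      exact absurd h0.2 (not_le.2 (mul_pos (not_le.1 h) (hq _)))
    simp only [ρ] at h1 h2
    linarith

lemma rpow_altDiff_le (i l : Fin (K + 1)) (hadm : N.Admissible i l) (c : Channel)
    (z : EuclideanSpace ℝ (Fin 2)) : N.altDiff i l ^ N.α .los ≤ N.dist i l z ^ N.α c := by
  have h0 := N.altDiff_nonneg i l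
  have h1 := N.altDiff_le_dist i l z
  have hα : N.α .los ≤ N.α c := by
    cases c
    · exact le_rfl
    · exact N.α_le
  refine le_trans ?_ (Real.rpow_le_rpow h0 h1 (N.α_pos c).le)
  rcases h0.eq_or_lt with h | h
  · rw [← h, Real.zero_rpow (N.α_pos _).ne', Real.zero_rpow (N.α_pos _).ne']
  · rcases le_or_gt 1 (N.altDiff i l) with h' | h'
    · exact Real.rpow_le_rpow_of_exponent_le h' hα
    · have he := hadm ⟨h, h'⟩
      cases c
      · exact le_rfl
      · rw [he]

lemma two_pi_mul_ε_eq (i l : Fin (K + 1)) :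
    ENNReal.ofReal (2 * Real.pi) * N.ε i l = ∫⁻ z : EuclideanSpace ℝ (Fin 2), ∑ c, ENNReal.ofReal
      (N.ρ i l c (N.dist i l z) *
        (1 - 1 / (1 + N.β i l * N.altDiff i l ^ N.α .los * N.dist i l z ^ (-N.α c)))) := by
  have hβ := (N.β_pos i l).le
  have h0 := N.altDiff_nonneg i l
  let f : ℝ → ℝ≥0∞ := fun x => ∑ c, ENNReal.ofReal (N.ρ i l c x *
    (1 - 1 / (1 + N.β i l * N.altDiff i l ^ N.α .los * x ^ (-N.α c))))
  have hf : Measurable f := Finset.measurable_sum _ fun c _ => by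
    have := N.measurable_ρ i l c
    fun_prop
  refine Eq.trans ?_ (lintegral_comp_sqrt_norm_sq_add h0 hf).symm
  rw [ε]
  refine congrArg _ (setLIntegral_congr_fun measurableSet_Ioi fun x hx => ?_)
  have hx0 : 0 ≤ x := h0.trans (le_of_lt hx)
  have hnn (c : Channel) : 0 ≤ N.ρ i l c x *
      (1 - 1 / (1 + N.β i l * N.altDiff i l ^ N.α .los * x ^ (-N.α c))) := by
    refine mul_nonneg (N.ρ_nonneg _ _ _ _) (sub_nonneg.2 (div_le_one_of_le₀ ?_ ?_))
    · have : 0 ≤ N.β i l * N.altDiff i l ^ N.α .los * x ^ (-N.α c) := by positivity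
      linarith
    · positivity
  simp only [f]
  rw [← ENNReal.ofReal_sum_of_nonneg fun c _ => hnn c, ← ENNReal.ofReal_mul hx0, sum_channel]
  congr 2
  simp only [ρ]
  ring

lemma le_attenuation_txExponent (hm : ∀ c, N.m c = 1) (i l : Fin (K + 1))
    (hadm : N.Admissible i l) (c : Channel) {z : EuclideanSpace ℝ (Fin 2)} (hz : z ≠ 0) :
    ENNReal.ofReal (2 * Real.pi) * N.ε i l ≤ N.attenuation i (N.txExponent l i c z) l := by
  have hd := N.dist_pos i l hz
  have hP := N.power_pos l
  have hβ := N.β_pos i l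
  have hs : 0 ≤ N.β i l / (N.power l * N.dist i l z ^ (-N.α c)) := by positivity
  have h1 := N.attenuation_mul_nodePower hm i l hs
  rw [← lintegral_finsetSum _ fun c _ => by fun_prop] at h1
  refine le_trans ?_ h1.ge
  rw [two_pi_mul_ε_eq]
  refine lintegral_mono fun z' => Finset.sum_le_sum fun c' _ => ENNReal.ofReal_le_ofReal
    (mul_le_mul_of_nonneg_left ?_ (N.ρ_nonneg _ _ _ _))
  have hd' : 0 ≤ N.dist i l z' ^ (-N.α c') := Real.rpow_nonneg (N.dist_nonneg i l z') _
  have hh : 0 ≤ N.altDiff i l ^ N.α .los := Real.rpow_nonneg (N.altDiff_nonneg i l) _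
  refine sub_le_sub_left (one_div_le_one_div_of_le (by positivity) (add_le_add_right ?_ _)) _
  have h2 : N.β i l / (N.power l * N.dist i l z ^ (-N.α c)) *
      (N.power l * N.dist i l z' ^ (-N.α c')) =
      N.β i l * N.dist i l z ^ N.α c * N.dist i l z' ^ (-N.α c') := by
    rw [Real.rpow_neg hd.le (N.α c)]
    have := Real.rpow_pos_of_pos hd (N.α c)
    field_simp
  rw [h2]
  exact mul_le_mul_of_nonneg_right
    (mul_le_mul_of_nonneg_left (N.rpow_altDiff_le i l hadm c z) hβ.le) hd'

lemma attenuation_txExponent_pos (hm : ∀ c, N.m c = 1) (k i l : Fin (K + 1)) (c : Channel)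
    {z : EuclideanSpace ℝ (Fin 2)} (hz : z ≠ 0) : 0 < N.attenuation i (N.txExponent k i c z) l :=
  N.attenuation_mul_nodePower_pos hm i l (div_pos (N.β_pos i k)
    (mul_pos (N.power_pos k) (Real.rpow_pos_of_pos (N.dist_pos i k hz) _)))

lemma attenuation_txExponent_le_rxExponent (k : Fin (K + 1)) (a : Criterion) (i l : Fin (K + 1))
    (c : Channel) (z : EuclideanSpace ℝ (Fin 2)) :
    N.attenuation k (N.txExponent i k c z) l ≤ N.attenuation k (N.rxExponent k a i c z) l :=
  N.attenuation_mono k l fun _ => le_add_self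

lemma measurable_attenuation (i l : Fin (K + 1)) {u : EuclideanSpace ℝ (Fin 2) → Node K → ℝ≥0∞}
    (hu : Measurable (Function.uncurry u)) : Measurable fun z => N.attenuation i (u z) l := by
  have := N.isProbabilityMeasure_gainLaw
  refine Finset.measurable_sum _ fun c _ => ?_
  have h1 : Measurable fun q : (EuclideanSpace ℝ (Fin 2) × EuclideanSpace ℝ (Fin 2)) × ℝ =>
      (q.1.1, ((l, c, q.1.2, q.2) : Node K)) := by fun_prop
  have h2 : Measurable fun q : (EuclideanSpace ℝ (Fin 2) × EuclideanSpace ℝ (Fin 2)) × ℝ =>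
      1 - expNeg (Function.uncurry u (q.1.1, ((l, c, q.1.2, q.2) : Node K))) :=
    measurable_const.sub (measurable_expNeg.comp (hu.comp h1))
  have h3 : Measurable fun q : EuclideanSpace ℝ (Fin 2) × EuclideanSpace ℝ (Fin 2) =>
      ∫⁻ g, (1 - expNeg (u q.1 (l, c, q.2, g))) ∂(N.gainLaw c) := h2.lintegral_prod_right'
  have h4 : Measurable fun q : EuclideanSpace ℝ (Fin 2) × EuclideanSpace ℝ (Fin 2) =>
      ENNReal.ofReal (N.ρ i l c (N.dist i l q.2)) *
        ∫⁻ g, (1 - expNeg (u q.1 (l, c, q.2, g))) ∂(N.gainLaw c) :=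
    ((N.measurable_ρ_dist i l c).ennreal_ofReal.comp measurable_snd).mul h3
  exact h4.lintegral_prod_right'

end Network
/-! ## Strict decrease as long as nonzero -/

/-- `x` is smaller than `y` unless it vanishes. -/
def Drops (x y : ℝ≥0∞) : Prop := x = 0 ∨ x < y

namespace Drops

lemma le {x y : ℝ≥0∞} (h : Drops x y) : x ≤ y := by
  rcases h with rfl | h
  · exact zero_le
  · exact h.le

lemma ne_top {x y : ℝ≥0∞} (h : Drops x y) : x ≠ ∞ := by
  rcases h with rfl | h
  · exact ENNReal.zero_ne_top
  · exact h.ne_top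

lemma const_mul {x y w : ℝ≥0∞} (hw : w ≠ ∞) (h : Drops x y) : Drops (w * x) (w * y) := by
  rcases eq_or_ne w 0 with rfl | hw0
  · exact .inl (zero_mul _)
  rcases h with rfl | h
  · exact .inl (mul_zero _)
  · exact .inr ((ENNReal.mul_lt_mul_iff_right hw0 hw).2 h)

lemma add {x y x' y' : ℝ≥0∞} (h : Drops x y) (h' : Drops x' y') : Drops (x + x') (y + y') := by
  rcases h with rfl | hlt
  · rcases h' with rfl | h'
    · exact .inl (add_zero _)
    · rw [zero_add]
      exact .inr (h'.trans_le le_add_self)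
  · exact .inr (ENNReal.add_lt_add_of_lt_of_le h'.ne_top hlt h'.le)

lemma sum {ι : Type*} (s : Finset ι) {f g : ι → ℝ≥0∞} (h : ∀ i ∈ s, Drops (f i) (g i)) :
    Drops (∑ i ∈ s, f i) (∑ i ∈ s, g i) := by
  classical
  induction s using Finset.induction_on with
  | empty => exact .inl rfl
  | insert i s hi ih =>
    rw [Finset.sum_insert hi, Finset.sum_insert hi]
    exact (h i (Finset.mem_insert_self i s)).add
      (ih fun j hj => h j (Finset.mem_insert_of_mem hj))

lemma lintegral {α : Type*} [MeasurableSpace α] {μ : Measure α} {f g : α → ℝ≥0∞}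
    (hg : Measurable g) (hf : ∫⁻ x, f x ∂μ ≠ ∞) (h : ∀ᵐ x ∂μ, Drops (f x) (g x)) :
    Drops (∫⁻ x, f x ∂μ) (∫⁻ x, g x ∂μ) := by
  by_cases h0 : ∀ᵐ x ∂μ, f x = 0
  · exact .inl ((lintegral_congr_ae h0).trans lintegral_zero)
  · refine .inr (lintegral_strict_mono_of_ae_le_of_frequently_ae_lt hg.aemeasurable hf
      (h.mono fun x hx => hx.le) ?_)
    refine (not_eventually.1 h0).mp (h.mono fun x hx hne => ?_)
    exact (hx.resolve_left hne).ne

lemma expNeg_mul {s t : ℝ≥0} (hst : s < t) {a : ℝ≥0∞} (ha : 0 < a) :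
    Drops (expNeg (t * a)) (expNeg (s * a)) := by
  rcases eq_or_ne a ∞ with rfl | ha'
  · rw [ENNReal.mul_top (by exact_mod_cast hst.bot_lt.ne'), expNeg_top]
    exact .inl rfl
  · exact .inr (expNeg_strictAnti
      ((ENNReal.mul_lt_mul_iff_left ha.ne' ha').2 (by exact_mod_cast hst)))

lemma mul_expNeg_mul {s t : ℝ≥0} (hst : s < t) {a : ℝ≥0∞} (ha : a⁻¹ ≤ s) :
    Drops (t * expNeg (t * a)) (s * expNeg (s * a)) := by
  rcases eq_or_ne a ∞ with rfl | ha'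
  · rw [ENNReal.mul_top (by exact_mod_cast hst.bot_lt.ne'), expNeg_top, mul_zero]
    exact .inl rfl
  · right
    lift a to ℝ≥0 using ha'
    have h1 : (1 : ℝ≥0∞) ≤ (s * a : ℝ≥0) := by
      rw [ENNReal.coe_mul]
      rwa [ENNReal.inv_le_iff_le_mul (fun h => absurd h ENNReal.coe_ne_top)
        (fun h => absurd h ENNReal.coe_ne_top), mul_comm] at ha
    have h2 : (1 : ℝ) ≤ s * a := by exact_mod_cast h1
    have hst' : (s : ℝ) < t := hst
    have hs : (0 : ℝ) < s := by
      rcases s.coe_nonneg.eq_or_lt with h | h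
      · rw [← h] at h2
        norm_num at h2
      · exact h
    have ha : (0 : ℝ) < a := pos_of_mul_pos_right (lt_of_lt_of_le one_pos h2) hs.le
    have key : (t : ℝ) * Real.exp (-(t * a)) < s * Real.exp (-(s * a)) := by
      have h3 : ((t : ℝ) - s) * a + 1 < Real.exp ((t - s) * a) :=
        Real.add_one_lt_exp (mul_pos (sub_pos.2 hst') ha).ne'
      have h4 : (t : ℝ) < s * Real.exp ((t - s) * a) := by nlinarith
      have h5 : Real.exp (-(s * a)) = Real.exp ((t - s) * a) * Real.exp (-(t * a)) := by
        rw [← Real.exp_add]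
        congr 1
        ring
      rw [h5, ← mul_assoc]
      exact mul_lt_mul_of_pos_right h4 (Real.exp_pos _)
    have h6 (r : ℝ≥0) : (r : ℝ≥0∞) * expNeg (r * a) =
        ENNReal.ofReal (r * Real.exp (-(r * a))) := by
      rw [ENNReal.ofReal_mul r.coe_nonneg, ENNReal.ofReal_coe_nnreal,
        ← expNeg_ofReal (by positivity), ENNReal.ofReal_mul r.coe_nonneg,
        ENNReal.ofReal_coe_nnreal, ENNReal.ofReal_coe_nnreal]
    rw [h6, h6]
    exact (ENNReal.ofReal_lt_ofReal_iff_of_nonneg (by positivity)).2 key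

end Drops

lemma isOptimalDensityBound_of_drops {f : ℝ≥0 → ℝ≥0∞} {b : ℝ≥0∞}
    (h : ∀ s t : ℝ≥0, b ≤ s → s < t → Drops (f t) (f s)) : IsOptimalDensityBound f b := by
  refine ⟨fun t ht => ?_, fun s t hs hst h0 => (h s t hs hst).resolve_left h0.ne'⟩
  by_contra! hbt
  have hb := hbt.ne_top
  have h1 : b.toNNReal < t := by
    rw [← ENNReal.coe_lt_coe, ENNReal.coe_toNNReal hb]
    exact hbt
  exact ((h b.toNNReal t (ENNReal.coe_toNNReal hb).ge h1).resolve_left ht.1.ne').not_ge (ht.2 _)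

namespace Network

variable {K : ℕ} (N : Network K)

lemma sum_update_mul (j : Fin (K + 1)) (w : Fin (K + 1) → ℝ≥0) (t : ℝ≥0)
    (x : Fin (K + 1) → ℝ≥0∞) :
    ∑ l, (Function.update w j t l : ℝ≥0∞) * x l =
      ∑ l ∈ Finset.univ.erase j, (w l : ℝ≥0∞) * x l + t * x j := by
  rw [← Finset.sum_erase_add _ _ (Finset.mem_univ j), Function.update_self]
  refine congrArg (· + _) (Finset.sum_congr rfl fun l hl => ?_)
  rw [Function.update_of_ne (Finset.ne_of_mem_erase hl)]

lemma drops_sum_lintegral (j : Fin (K + 1)) (w : Fin (K + 1) → ℝ≥0)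
    {q : Channel → EuclideanSpace ℝ (Fin 2) → ℝ≥0∞} (hq : ∀ c, Measurable (q c))
    (hq' : ∀ c z, q c z ≠ ∞) {x : Channel → EuclideanSpace ℝ (Fin 2) → Fin (K + 1) → ℝ≥0∞}
    (hx : ∀ c l, Measurable fun z => x c z l) {s t u v : ℝ≥0}
    (h : ∀ c z, z ≠ 0 → Drops (u * expNeg (t * x c z j)) (v * expNeg (s * x c z j)))
    (hfin : u * ∑ c, ∫⁻ z, q c z * expNeg (∑ l, (Function.update w j t l : ℝ≥0∞) * x c z l) ≠ ∞) :
    Drops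
      (u * ∑ c, ∫⁻ z, q c z * expNeg (∑ l, (Function.update w j t l : ℝ≥0∞) * x c z l))
      (v * ∑ c, ∫⁻ z, q c z * expNeg (∑ l, (Function.update w j s l : ℝ≥0∞) * x c z l)) := by
  have hz : ∀ᵐ z : EuclideanSpace ℝ (Fin 2), z ≠ 0 := Measure.ae_ne volume 0
  have hmeas (c : Channel) : Measurable fun z =>
      (v : ℝ≥0∞) * (q c z * expNeg (∑ l, (Function.update w j s l : ℝ≥0∞) * x c z l)) := by
    have := hq c
    have := hx c
    fun_prop
  rw [Finset.mul_sum] at hfin ⊢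
  rw [Finset.mul_sum]
  refine Drops.sum _ fun c hc => ?_
  have hfc := (ENNReal.sum_ne_top.1 hfin) c hc
  rw [← lintegral_const_mul' _ _ ENNReal.coe_ne_top] at hfc ⊢
  rw [← lintegral_const_mul' _ _ ENNReal.coe_ne_top]
  refine Drops.lintegral (hmeas c) hfc (hz.mono fun z hz => ?_)
  have hw : q c z * expNeg (∑ l ∈ Finset.univ.erase j, (w l : ℝ≥0∞) * x c z l) ≠ ∞ :=
    ENNReal.mul_ne_top (hq' c z) (expNeg_ne_top _)
  have key := (h c z hz).const_mul hw
  rw [sum_update_mul, sum_update_mul, expNeg_add, expNeg_add]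
  convert key using 1 <;> ring

lemma measurable_assocProb (k : Fin (K + 1)) (a : Criterion) (i : Fin (K + 1)) (c : Channel) :
    Measurable (N.assocProb k a i c) := by
  have := N.isProbabilityMeasure_gainLaw
  have hσ : SigmaFinite (N.rxIntensity k) :=
    sigmaFinite_nodeIntensity (r := fun l c z => N.ρ l k c (N.dist l k z))
  have h1 : Measurable fun q : EuclideanSpace ℝ (Fin 2) × Node K => 1 - expNeg (∞ *
      {y | N.assocVal k a (i, c, q.1, 0) < N.assocVal k a y}.indicator (1 : Node K → ℝ≥0∞) q.2) :=
    measurable_const.sub (measurable_expNeg.comp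
      ((N.measurable_indicator_assocVal k a i c).const_mul ∞))
  exact measurable_expNeg.comp h1.lintegral_prod_right'

lemma success_unique {Ω : Type*} {Tx Rx : Fin (K + 1) → Ω → Set (Node K)} {o : Subject}
    {a : Criterion} {k i i' : Fin (K + 1)} {ω : Ω}
    (h : N.Success o a k i Tx Rx ω) (h' : N.Success o a k i' Tx Rx ω) : i = i' := by
  cases o <;>
  · obtain ⟨c, z, g, h, -⟩ := h
    obtain ⟨c', z', g', h', -⟩ := h'
    exact congrArg Prod.fst (N.isAssociated_unique h h')

section Success

variable {s t : ℝ≥0}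
  {Ω Ω' : Type*} [MeasurableSpace Ω] [MeasurableSpace Ω'] {P : Measure Ω} [IsProbabilityMeasure P]
  {P' : Measure Ω'} [IsProbabilityMeasure P']
  {Tx Rx : Fin (K + 1) → Ω → Set (Node K)} {Tx' Rx' : Fin (K + 1) → Ω' → Set (Node K)}

lemma drops_rxSuccess (hm : ∀ c, N.m c = 1) (a : Criterion) (k j i : Fin (K + 1))
    (hadm : N.Admissible k j) (hs : N.bound k j ≤ s) (hst : s < t)
    (h : (N.withTx j s).IsRealization P Tx Rx) (h' : (N.withTx j t).IsRealization P' Tx' Rx') :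
    Drops (P' {ω | (N.withTx j t).RxSuccess k a i (Tx' k ω)})
      (P {ω | (N.withTx j s).RxSuccess k a i (Tx k ω)}) := by
  have e := (measure_rxSuccess (N.withTx j s) hm h k a i).2
  have e' := (measure_rxSuccess (N.withTx j t) hm h' k a i).2
  have hfin := measure_ne_top P' {ω | (N.withTx j t).RxSuccess k a i (Tx' k ω)}
  rw [e'] at hfin
  rw [e, e']
  refine drops_sum_lintegral j N.lamTx (u := Function.update N.lamTx j t i)
    (v := Function.update N.lamTx j s i)
    (q := fun c z => ENNReal.ofReal (N.ρ k i c (N.dist k i z)) *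
      expNeg (N.linkCoeff k i c z * N.noise))
    (x := fun c z l => N.attenuation k (N.rxExponent k a i c z) l)
    (fun c => ?_) (fun c z => ENNReal.mul_ne_top ENNReal.ofReal_ne_top (expNeg_ne_top _))
    (fun c l => N.measurable_attenuation k l (N.measurable_rxExponent k a i c))
    (fun c z hz => ?_) hfin
  · have := N.measurable_ρ_dist k i c
    fun_prop
  · have hle := N.attenuation_txExponent_le_rxExponent k a i j c z
    rcases eq_or_ne i j with rfl | hij
    · rw [Function.update_self, Function.update_self]
      refine Drops.mul_expNeg_mul hst (le_trans (ENNReal.inv_le_inv.2 ?_) hs)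
      exact (N.le_attenuation_txExponent hm k i hadm c hz).trans hle
    · rw [Function.update_of_ne hij, Function.update_of_ne hij]
      exact (Drops.expNeg_mul hst ((N.attenuation_txExponent_pos hm i k j c hz).trans_le
        hle)).const_mul ENNReal.coe_ne_top

lemma drops_mul_txSuccess (hm : ∀ c, N.m c = 1) (a : Criterion) (k j i : Fin (K + 1))
    (h : (N.withTx j s).IsRealization P Tx Rx) (h' : (N.withTx j t).IsRealization P' Tx' Rx')
    (u v : ℝ≥0)
    (huv : N.lamRx i ≠ 0 → ∀ c z, z ≠ 0 → Drops
      (u * expNeg (t * N.attenuation i (N.txExponent k i c z) j))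
      (v * expNeg (s * N.attenuation i (N.txExponent k i c z) j))) :
    Drops (u * P' {ω | (N.withTx j t).TxSuccess k a i (Rx' k ω) fun l => Tx' l ω})
      (v * P {ω | (N.withTx j s).TxSuccess k a i (Rx k ω) fun l => Tx l ω}) := by
  have e := (measure_txSuccess (N.withTx j s) hm h k a i).2
  have e' := (measure_txSuccess (N.withTx j t) hm h' k a i).2
  have hfin : (u : ℝ≥0∞) *
      P' {ω | (N.withTx j t).TxSuccess k a i (Rx' k ω) fun l => Tx' l ω} ≠ ∞ :=
    ENNReal.mul_ne_top ENNReal.coe_ne_top (measure_ne_top _ _)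
  rw [e', ← mul_assoc, ← ENNReal.coe_mul] at hfin
  rw [e, e', ← mul_assoc, ← mul_assoc, ← ENNReal.coe_mul, ← ENNReal.coe_mul]
  by_cases h0 : N.lamRx i = 0
  · left
    have h1 : (N.withTx j t).lamRx i = 0 := h0
    rw [h1, mul_zero, ENNReal.coe_zero, zero_mul]
  refine drops_sum_lintegral j N.lamTx (u := u * N.lamRx i) (v := v * N.lamRx i)
    (q := fun c z => ENNReal.ofReal (N.ρ i k c (N.dist i k z)) *
      (N.assocProb k a i c z * expNeg (N.linkCoeff i k c z * N.noise)))
    (x := fun c z l => N.attenuation i (N.txExponent k i c z) l)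
    (fun c => ?_) (fun c z => ENNReal.mul_ne_top ENNReal.ofReal_ne_top
      (ENNReal.mul_ne_top (expNeg_ne_top _) (expNeg_ne_top _)))
    (fun c l => N.measurable_attenuation i l (N.measurable_txExponent k i c))
    (fun c z hz => ?_) hfin
  · have := N.measurable_ρ_dist i k c
    have := N.measurable_assocProb k a i c
    fun_prop
  · have key := (huv h0 c z hz).const_mul (w := N.lamRx i) ENNReal.coe_ne_top
    rw [ENNReal.coe_mul, ENNReal.coe_mul]
    convert key using 1 <;> ring

lemma drops_txSuccess (hm : ∀ c, N.m c = 1) (a : Criterion) (k j i : Fin (K + 1)) (hst : s < t)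
    (h : (N.withTx j s).IsRealization P Tx Rx) (h' : (N.withTx j t).IsRealization P' Tx' Rx') :
    Drops (P' {ω | (N.withTx j t).TxSuccess k a i (Rx' k ω) fun l => Tx' l ω})
      (P {ω | (N.withTx j s).TxSuccess k a i (Rx k ω) fun l => Tx l ω}) := by
  have key := N.drops_mul_txSuccess hm a k j i h h' 1 1 fun _ c z hz =>
    (Drops.expNeg_mul hst (N.attenuation_txExponent_pos hm k i j c hz)).const_mul
      (w := ((1 : ℝ≥0) : ℝ≥0∞)) ENNReal.coe_ne_top
  simpa only [ENNReal.coe_one, one_mul] using key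

lemma drops_density_mul_txSuccess (hm : ∀ c, N.m c = 1) (a : Criterion) (k i : Fin (K + 1))
    (hadm : 0 < N.lamRx i → N.Admissible i k) (hs : (⨆ i, ⨆ _ : 0 < N.lamRx i, N.bound i k) ≤ s)
    (hst : s < t) (h : (N.withTx k s).IsRealization P Tx Rx)
    (h' : (N.withTx k t).IsRealization P' Tx' Rx') :
    Drops (t * P' {ω | (N.withTx k t).TxSuccess k a i (Rx' k ω) fun l => Tx' l ω})
      (s * P {ω | (N.withTx k s).TxSuccess k a i (Rx k ω) fun l => Tx l ω}) := by
  refine N.drops_mul_txSuccess hm a k k i h h' t s fun h0 c z hz => ?_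
  have hpos : 0 < N.lamRx i := pos_of_ne_zero h0
  refine Drops.mul_expNeg_mul hst ((ENNReal.inv_le_inv.2
    (N.le_attenuation_txExponent hm i k (hadm hpos) c hz)).trans (le_trans ?_ hs))
  exact le_iSup₂ (f := fun i (_ : 0 < N.lamRx i) => N.bound i k) i hpos

lemma nullMeasurableSet_success (hm : ∀ c, N.m c = 1) (h : N.IsRealization P Tx Rx) (o : Subject)
    (a : Criterion) (k i : Fin (K + 1)) :
    NullMeasurableSet {ω | N.Success o a k i Tx Rx ω} P := by
  cases o
  · exact (N.measure_rxSuccess hm h k a i).1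
  · exact (N.measure_txSuccess hm h k a i).1

lemma STP_eq_sum (hm : ∀ c, N.m c = 1) (h : N.IsRealization P Tx Rx) (o : Subject)
    (a : Criterion) (k : Fin (K + 1)) :
    N.STP o a k P Tx Rx = ∑ i, P {ω | N.Success o a k i Tx Rx ω} := by
  have hset : {ω | ∃ i, N.Success o a k i Tx Rx ω} = ⋃ i, {ω | N.Success o a k i Tx Rx ω} := by
    ext ω
    simp
  rw [STP, hset, measure_iUnion₀ (fun i i' hne => Disjoint.aedisjoint ?_)
    (N.nullMeasurableSet_success hm h o a k), tsum_fintype]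
  exact Set.disjoint_left.2 fun ω h1 h2 => hne (N.success_unique h1 h2)

end Success

end Network
end MAN

open MAN

theorem corollary2 {K : ℕ} (N : Network K) (hm : ∀ c, N.m c = 1) (a : Criterion)
    (k j : Fin (K + 1))
    {Ω : ℝ≥0 → Type*} [∀ t, MeasurableSpace (Ω t)]
    (P : ∀ t, Measure (Ω t)) [∀ t, IsProbabilityMeasure (P t)]
    (Tx Rx : ∀ t, Fin (K + 1) → Ω t → Set (Node K))
    (hreal : ∀ t, (N.withTx j t).IsRealization (P t) (Tx t) (Rx t)) :
    -- receiver-oriented association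
    (N.Admissible k j →
      IsOptimalDensityBound
        (fun t => (N.withTx j t).STP .receiver a k (P t) (Tx t) (Rx t)) (N.bound k j) ∧
      IsOptimalDensityBound
        (fun t => (N.withTx j t).ASE .receiver a k (P t) (Tx t) (Rx t)) (N.bound k j)) ∧
    -- transmitter-oriented association
    IsOptimalDensityBound
      (fun t => (N.withTx j t).STP .transmitter a k (P t) (Tx t) (Rx t)) 0 ∧
    (k ≠ j → IsOptimalDensityBound
      (fun t => (N.withTx j t).ASE .transmitter a k (P t) (Tx t) (Rx t)) 0) ∧
    (k = j → (∀ i, 0 < N.lamRx i → N.Admissible i k) → IsOptimalDensityBound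
      (fun t => (N.withTx j t).ASE .transmitter a k (P t) (Tx t) (Rx t))
      (⨆ i, ⨆ _ : 0 < N.lamRx i, N.bound i k)) := by
  have hSTP (t : ℝ≥0) (o : Subject) := (N.withTx j t).STP_eq_sum hm (hreal t) o a k
  refine ⟨fun hadm => ⟨?_, ?_⟩, ?_, fun hkj => ?_, ?_⟩
  · refine isOptimalDensityBound_of_drops fun s t hs hst => ?_
    rw [hSTP, hSTP]
    exact Drops.sum _ fun i _ => N.drops_rxSuccess hm a k j i hadm hs hst (hreal s) (hreal t)
  · refine isOptimalDensityBound_of_drops fun s t hs hst => ?_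
    exact (Drops.sum _ fun i _ => (N.drops_rxSuccess hm a k j i hadm hs hst (hreal s)
      (hreal t)).const_mul ENNReal.ofReal_ne_top).const_mul ENNReal.coe_ne_top
  · refine isOptimalDensityBound_of_drops fun s t _ hst => ?_
    rw [hSTP, hSTP]
    exact Drops.sum _ fun i _ => N.drops_txSuccess hm a k j i hst (hreal s) (hreal t)
  · refine isOptimalDensityBound_of_drops fun s t _ hst => ?_
    have hl (r : ℝ≥0) : (N.withTx j r).linkDensity .transmitter k = N.lamTx k :=
      Function.update_of_ne hkj _ _
    rw [Network.ASE, Network.ASE, hl, hl]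
    exact (Drops.sum _ fun i _ => (N.drops_txSuccess hm a k j i hst (hreal s)
      (hreal t)).const_mul ENNReal.ofReal_ne_top).const_mul ENNReal.coe_ne_top
  · rintro rfl hadm
    refine isOptimalDensityBound_of_drops fun s t hs hst => ?_
    have hl (r : ℝ≥0) : (N.withTx k r).linkDensity .transmitter k = r :=
      Function.update_self _ _ _
    rw [Network.ASE, Network.ASE, hl, hl, Finset.mul_sum, Finset.mul_sum]
    refine Drops.sum _ fun i _ => ?_
    rw [mul_left_comm, mul_left_comm (s : ℝ≥0∞)]
    exact (N.drops_density_mul_txSuccess hm a k i (hadm i) hs hst (hreal s)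
      (hreal t)).const_mul ENNReal.ofReal_ne_top
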